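/- Let $(\Omega,\pi)$ be an atomless probability space with separable $\sigma$-algebra, and let $\mathcal W\subseteq L^\infty(\Omega^2)$ be the space of kernels, that is, bounded measurable functions $W$ with $W(x,y)=W(y,x)$ (up to null sets), with the norm $\|\cdot\|_\infty$. For an integer $k\ge 1$ let $\mathcal H_k$ be the set of all graphs on the vertex set $[k]=\{1,\dots,k\}$. A *rule of order $k$* is a matrix $\mathcal R=(\mathcal R_{F,H})_{F,H\in\mathcal H_k}$ with entries in $[0,1]$ such that $\sum_{H\in\mathcal H_k}\mathcal R_{F,H}=1$ for every $F\in\mathcal H_k$. For $F\in\mathcal H_k$ and distinct $a,b\in[k]$ and $W\in\mathcal W$ put $$T_{F^{a,b}}W(x,y)=\int\prod_{ij\in E(F)}W(x_i,x_j)\prod_{ij\notin E(F)}\bigl(1-W(x_i,x_j)\bigr)\,\mathrm d\pi^{[k]\setminus\{a,b\}},$$ where $x_a=x$ and $x_b=y$ are fixed, the products are over unordered pairs of distinct vertices, and the integral is over $(x_i)_{i\ne a,b}$. The *velocity operator* $\mathfrak V_{\mathcal R}:\mathcal W\to\mathcal W$ of a rule $\mathcal R$ of order $k$ is $$\mathfrak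 V_{\mathcal R}W=\sum_{F\in\mathcal H_k}\ \sum_{(a,b)\in[k]^2,\,a\ne b}T_{F^{a,b}}W\cdot\Bigl(\sum_{H\in\mathcal H_k}\mathcal R_{F,H}\mathbf 1_{ab\in E(H)}-\mathbf 1_{ab\in E(F)}\Bigr).$$ A *trajectory* of $\mathcal R$ starting at $W\in\mathcal W$ is a function $t\mapsto\Phi^tW$ from an open interval $I\ni 0$ to $\mathcal W$, differentiable with respect to $\|\cdot\|_\infty$, with $\Phi^0W=W$ and $\frac{\mathrm d}{\mathrm dt}\Phi^tW=\mathfrak V_{\mathcal R}\Phi^tW$ on $I$. It is *maximal* if every trajectory of $\mathcal R$ starting at $W$ is a restriction of it. Two rules *have the same trajectories* if for every $W\in\mathcal W$ their maximal trajectories starting at $W$ exist, have the same domain and agree on it. A rule $\mathcal R$ of order $k$ is *unique* if no other rule of order $k$ has the same trajectories as $\mathcal R$. It is *symmetric* if $\mathcal R_{\sigma\cdot F,\sigma\cdot H}=\mathcal R_{F,H}$ for all $F,H\in\mathcal H_k$ and all permutations $\sigma$ of $[k]$, where $\sigma\cdot F$ is the graph on $[k]$ in which $\sigma(i)\sigma(j)$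 is an edge if and only if $ij\in E(F)$. It is *deterministic* if for every $F\in\mathcal H_k$ there is a unique $G\in\mathcal H_k$ such that $\mathcal R_{F,H}=\mathbf 1_{H=G}$ for all $H\in\mathcal H_k$. **Theorem.** Let $k\ge1$. A rule $\mathcal R$ of order $k$ is unique if and only if $\mathcal R$ is both symmetric and deterministic, or $k=2$. -/

import Mathlib

open MeasureTheory
open scoped ENNReal

namespace FlipProcess

/-- A rule of order `k`: a row-stochastic matrix indexed by the labelled graphs on `[k]`. -/
@[ext]
structure Rule (k : ℕ) where
  prob : SimpleGraph (Fin k) → SimpleGraph (Fin k) → ℝ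
  nonneg : ∀ F H, 0 ≤ prob F H
  le_one : ∀ F H, prob F H ≤ 1
  sum_eq_one : ∀ F, ∑ H, prob F H = 1

/-- The relabelled graph `σ · F`, in which `σ i ∼ σ j` if and only if `i ∼ j` in `F`. -/
def relabel {k : ℕ} (σ : Equiv.Perm (Fin k)) (F : SimpleGraph (Fin k)) : SimpleGraph (Fin k) :=
  F.map σ

theorem relabel_adj {k : ℕ} (σ : Equiv.Perm (Fin k)) (F : SimpleGraph (Fin k)) (i j : Fin k) :
    (relabel σ F).Adj (σ i) (σ j) ↔ F.Adj i j := by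
  unfold relabel
  rw [SimpleGraph.map_adj']
  constructor
  · rintro ⟨_, u, v, h, hu, hv⟩
    rwa [σ.injective hu, σ.injective hv] at h
  · intro h
    exact ⟨fun e => h.ne (σ.injective e), i, j, h, rfl, rfl⟩

/-- A rule is symmetric if it is invariant under simultaneous relabelling. -/
def Rule.IsSymmetric {k : ℕ} (R : Rule k) : Prop :=
  ∀ (F H : SimpleGraph (Fin k)) (σ : Equiv.Perm (Fin k)),
    R.prob (relabel σ F) (relabel σ H) = R.prob F H

open Classical in
/-- A rule is deterministic if every drawn graph has exactly one possible replacement. -/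
def Rule.IsDeterministic {k : ℕ} (R : Rule k) : Prop :=
  ∀ F : SimpleGraph (Fin k), ∃! G : SimpleGraph (Fin k), ∀ H, R.prob F H = if H = G then 1 else 0

/-- Every measurable set of positive measure has a measurable subset of strictly smaller
positive measure. -/
def IsAtomless {Ω : Type*} [MeasurableSpace Ω] (π : Measure Ω) : Prop :=
  ∀ A : Set Ω, MeasurableSet A → 0 < π A →
    ∃ B : Set Ω, B ⊆ A ∧ MeasurableSet B ∧ 0 < π B ∧ π B < π A

/-- The space of kernels, a subspace of `L^∞(Ω²)` with the `L^∞` norm: its elements are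
the (classes of) bounded measurable functions `W` with `W (y, x) = W (x, y)`. -/
def kernels {Ω : Type*} [MeasurableSpace Ω] (π : Measure Ω) [IsProbabilityMeasure π] :
    Submodule ℝ (Lp ℝ ∞ (π.prod π)) where
  carrier := {W | (fun p : Ω × Ω => W p.swap) =ᵐ[π.prod π] W}
  add_mem' := by
    intro U W hU hW
    have h := Lp.coeFn_add U W
    have h' := (Measure.measurePreserving_swap (μ := π) (ν := π)).quasiMeasurePreserving.ae h
    simp only [Set.mem_ofPred_eq] at hU hW ⊢
    filter_upwards [h, h', hU, hW] with p h1 h2 h3 h4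
    simp only [Pi.add_apply] at h1 h2
    rw [h1, h2, h3, h4]
  zero_mem' := by
    have h := Lp.coeFn_zero ℝ ∞ (π.prod π)
    have h' := (Measure.measurePreserving_swap (μ := π) (ν := π)).quasiMeasurePreserving.ae h
    simp only [Set.mem_ofPred_eq]
    filter_upwards [h, h'] with p h1 h2
    rw [h1, h2]
    rfl
  smul_mem' := by
    intro c W hW
    have h := Lp.coeFn_smul c W
    have h' := (Measure.measurePreserving_swap (μ := π) (ν := π)).quasiMeasurePreserving.ae h
    simp only [Set.mem_ofPred_eq] at hW ⊢
    filter_upwards [h, h', hW] with p h1 h2 h3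
    simp only [Pi.smul_apply] at h1 h2
    rw [h1, h2, h3]

/-- The point `(x_i)_{i ∈ [k]}` with `x_a = x`, `x_b = y` and the other coordinates given by
`z`. -/
def rootedPoint {k : ℕ} {Ω : Type*} (a b : Fin k) (x y : Ω)
    (z : {i : Fin k // i ≠ a ∧ i ≠ b} → Ω) (i : Fin k) : Ω :=
  if ha : i = a then x else if hb : i = b then y else z ⟨i, ha, hb⟩

open Classical in
/-- The induced density of the rooted graph `F^{a,b}` in `W` at `(x, y)`. The unordered pairs
of vertices are listed as the pairs `p` with `p.1 < p.2`. -/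
noncomputable def rootedDensity {k : ℕ} {Ω : Type*} [MeasurableSpace Ω] (π : Measure Ω)
    (F : SimpleGraph (Fin k)) (a b : Fin k) (W : Ω × Ω → ℝ) (x y : Ω) : ℝ :=
  ∫ z : {i : Fin k // i ≠ a ∧ i ≠ b} → Ω,
    ∏ p : Fin k × Fin k with p.1 < p.2,
      (if F.Adj p.1 p.2
        then W (rootedPoint a b x y z p.1, rootedPoint a b x y z p.2)
        else 1 - W (rootedPoint a b x y z p.1, rootedPoint a b x y z p.2))
    ∂(Measure.pi fun _ => π)

open Classical in
/-- The velocity operator of the rule `R`, evaluated at `W`. -/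
noncomputable def velocity {k : ℕ} {Ω : Type*} [MeasurableSpace Ω] (π : Measure Ω)
    (R : Rule k) (W : Ω × Ω → ℝ) (p : Ω × Ω) : ℝ :=
  ∑ F : SimpleGraph (Fin k), ∑ r : Fin k × Fin k with r.1 ≠ r.2,
    rootedDensity π F r.1 r.2 W p.1 p.2 *
      ((∑ H : SimpleGraph (Fin k), R.prob F H * (if H.Adj r.1 r.2 then 1 else 0)) -
        (if F.Adj r.1 r.2 then 1 else 0))

/-- `φ`, restricted to the open interval `I`, is a trajectory of `R` starting at `W`: it is
differentiable in the `L^∞` norm, with derivative at `t` equal in `L^∞(Ω²)` to the velocity of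
`φ t`, and `φ 0 = W`. -/
structure IsTrajectory {k : ℕ} {Ω : Type*} [MeasurableSpace Ω] (π : Measure Ω)
    [IsProbabilityMeasure π] (R : Rule k) (W : kernels π) (I : Set ℝ) (φ : ℝ → kernels π) :
    Prop where
  isOpen : IsOpen I
  ordConnected : I.OrdConnected
  zero_mem : (0 : ℝ) ∈ I
  initial : φ 0 = W
  deriv : ∀ t ∈ I, ∃ V : kernels π, HasDerivAt φ V t ∧
    ((V : Lp ℝ ∞ (π.prod π)) : Ω × Ω → ℝ) =ᵐ[π.prod π]
      velocity π R ((φ t : Lp ℝ ∞ (π.prod π)) : Ω × Ω → ℝ)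

/-- `φ` on `I` is the maximal trajectory of `R` starting at `W`: every trajectory starting at
`W` is its restriction to a subinterval of `I`. -/
def IsMaximalTrajectory {k : ℕ} {Ω : Type*} [MeasurableSpace Ω] (π : Measure Ω)
    [IsProbabilityMeasure π] (R : Rule k) (W : kernels π) (I : Set ℝ) (φ : ℝ → kernels π) :
    Prop :=
  IsTrajectory π R W I φ ∧
    ∀ (J : Set ℝ) (ψ : ℝ → kernels π), IsTrajectory π R W J ψ → J ⊆ I ∧ Set.EqOn ψ φ J

/-- Two rules have the same trajectories if, from every kernel, their maximal trajectories have
the same domain and the same values on it. -/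
def HaveSameTrajectories {k₁ k₂ : ℕ} {Ω : Type*} [MeasurableSpace Ω] (π : Measure Ω)
    [IsProbabilityMeasure π] (R₁ : Rule k₁) (R₂ : Rule k₂) : Prop :=
  ∀ W : kernels π, ∃ (I : Set ℝ) (φ : ℝ → kernels π),
    IsMaximalTrajectory π R₁ W I φ ∧ IsMaximalTrajectory π R₂ W I φ

/-- A rule is unique if no other rule of the same order has the same trajectories. -/
def Rule.IsUnique {k : ℕ} {Ω : Type*} [MeasurableSpace Ω] (π : Measure Ω)
    [IsProbabilityMeasure π] (R : Rule k) : Prop :=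
  ∀ R' : Rule k, HaveSameTrajectories π R R' → R' = R

end FlipProcess

/-! The problem reduces to finite combinatorics in two steps.

Trajectories and velocities carry the same information. Kernels form a complete space on which the
velocity is Lipschitz on every ball, so maximal trajectories exist and are unique, and the
derivative at time 0 recovers the velocity (`haveSameTrajectories_iff`).

Velocities and orbit sums of edge probabilities carry the same information
(`haveSameTrajectories_iff_sum_edgeProb_eq`). Relabelling a rooted graph does not change its
density, so only orbit sums of drifts matter. Conversely, cut Ω into cells labelled by the vertices
of F, take the 0/1 step kernel of F and test its velocity against the cell (a, b). Samples hitting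
every cell once contribute exactly the orbit sum of the drift at (F, a, b). Letting the cell measure
be uniform on each nonempty set of cells isolates these samples by inclusion-exclusion. Atomlessness
supplies such partitions.

For a symmetric deterministic rule all terms of an orbit sum equal the same value, 0 or 1. Another
rule, with terms in [0,1], can match this sum only term by term, and extreme edge probabilities
force a point mass. For k = 2 relabelling is trivial and one edge probability determines a row.

Conversely, averaging over relabellings preserves orbit sums, so a unique rule is symmetric. Suppose
some row F charges H₁ ≠ H₂. If a relabelling moved (F, H₁), shifting mass between the two outcomes
at F and oppositely at the relabelled row would preserve orbit sums. Hence both outcomes are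
invariant, so they are the empty and the complete graph. For k ≥ 3 some of their mass can be moved
to a single edge and its complement without changing any edge probability, a contradiction. For k =
1 there is only one graph. -/

namespace FlipProcess

/-! ### Intermediate values and partitions for atomless measures -/

section Atomless

variable {Ω : Type*} [MeasurableSpace Ω] {π : Measure Ω} [IsFiniteMeasure π]

theorem IsAtomless.exists_subset_le_half (hπ : IsAtomless π) {A : Set Ω} (hA : MeasurableSet A)
    (h : 0 < π.real A) :
    ∃ B ⊆ A, MeasurableSet B ∧ 0 < π.real B ∧ π.real B ≤ π.real A / 2 := by
  obtain ⟨B, hBA, hB, h0, h1⟩ := hπ A hA (by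
    rw [Measure.real, ENNReal.toReal_pos_iff] at h; exact h.1)
  have h0' : 0 < π.real B := ENNReal.toReal_pos h0.ne' (measure_ne_top _ _)
  have h1' : π.real B < π.real A :=
    (ENNReal.toReal_lt_toReal (measure_ne_top _ _) (measure_ne_top _ _)).2 h1
  have hd : π.real (A \ B) = π.real A - π.real B := measureReal_sdiff hBA hB
  by_cases hh : π.real B ≤ π.real A / 2
  · exact ⟨B, hBA, hB, h0', hh⟩
  · exact ⟨A \ B, Set.sdiff_subset, hA.diff hB, by linarith, by linarith⟩

theorem IsAtomless.exists_subset_le (hπ : IsAtomless π) {A : Set Ω} (hA : MeasurableSet A)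
    (h : 0 < π.real A) {ε : ℝ} (hε : 0 < ε) :
    ∃ B ⊆ A, MeasurableSet B ∧ 0 < π.real B ∧ π.real B ≤ ε := by
  have key : ∀ n : ℕ, ∃ B ⊆ A, MeasurableSet B ∧ 0 < π.real B ∧
      π.real B ≤ π.real A * (1 / 2) ^ n := by
    intro n
    induction n with
    | zero => exact ⟨A, subset_rfl, hA, h, by simp⟩
    | succ n ih =>
      obtain ⟨B, hBA, hB, h0, h1⟩ := ih
      obtain ⟨C, hCB, hC, h2, h3⟩ := hπ.exists_subset_le_half hB h0
      exact ⟨C, hCB.trans hBA, hC, h2, by rw [pow_succ]; linarith⟩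
  obtain ⟨n, hn⟩ := exists_pow_lt_of_lt_one (div_pos hε h) (by norm_num : (1 / 2 : ℝ) < 1)
  obtain ⟨B, hBA, hB, h0, h1⟩ := key n
  refine ⟨B, hBA, hB, h0, h1.trans ?_⟩
  rw [lt_div_iff₀ h] at hn
  linarith

/-- Sierpiński's theorem: an atomless measure takes every intermediate value. -/
theorem IsAtomless.exists_subset_measureReal_eq (hπ : IsAtomless π) {A : Set Ω}
    (hA : MeasurableSet A) {c : ℝ} (hc : 0 ≤ c) (hcA : c ≤ π.real A) :
    ∃ B ⊆ A, MeasurableSet B ∧ π.real B = c := by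
  let S := {B : Set Ω // B ⊆ A ∧ MeasurableSet B ∧ π.real B ≤ c}
  -- Greedy enlargement: `B'` realises at least half of the largest gain available among admissible
  -- supersets of `B`.
  have step : ∀ B : S, ∃ B' : S, B.1 ⊆ B'.1 ∧
      ∀ C : S, B.1 ⊆ C.1 → π.real B.1 + π.real C.1 ≤ 2 * π.real B'.1 := by
    intro B
    let V : Set ℝ := {r | ∃ C : S, B.1 ⊆ C.1 ∧ π.real C.1 = r}
    have hbdd : BddAbove V := ⟨c, by rintro _ ⟨C, -, rfl⟩; exact C.2.2.2⟩
    have hne : V.Nonempty := ⟨_, B, subset_rfl, rfl⟩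
    by_cases hB : sSup V ≤ π.real B.1
    · refine ⟨B, subset_rfl, fun C hC => ?_⟩
      have : π.real C.1 ≤ sSup V := le_csSup hbdd ⟨C, hC, rfl⟩
      linarith
    · obtain ⟨_, ⟨B', hBB', rfl⟩, h⟩ := exists_lt_of_lt_csSup hne
        (show (π.real B.1 + sSup V) / 2 < sSup V by linarith)
      refine ⟨B', hBB', fun C hC => ?_⟩
      have : π.real C.1 ≤ sSup V := le_csSup hbdd ⟨C, hC, rfl⟩
      linarith
  choose next hnext hhalf using step
  let B : ℕ → S := fun n => next^[n] ⟨∅, Set.empty_subset _, MeasurableSet.empty, by simpa using hc⟩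
  have hsucc : ∀ n, B (n + 1) = next (B n) := fun n => Function.iterate_succ_apply' _ _ _
  have hmono : Monotone fun n => (B n).1 := monotone_nat_of_le_succ fun n => by
    rw [hsucc]; exact hnext _
  have hlim : Filter.Tendsto (fun n => π.real (B n).1) Filter.atTop
      (nhds (π.real (⋃ n, (B n).1))) :=
    (ENNReal.tendsto_toReal (measure_ne_top _ _)).comp (tendsto_measure_iUnion_atTop hmono)
  have hUA : (⋃ n, (B n).1) ⊆ A := Set.iUnion_subset fun n => (B n).2.1
  have hU : MeasurableSet (⋃ n, (B n).1) := MeasurableSet.iUnion fun n => (B n).2.2.1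
  have hUc : π.real (⋃ n, (B n).1) ≤ c := le_of_tendsto' hlim fun n => (B n).2.2.2
  refine ⟨_, hUA, hU, hUc.antisymm ?_⟩
  by_contra! hlt
  have hd : π.real (A \ ⋃ n, (B n).1) = π.real A - π.real (⋃ n, (B n).1) :=
    measureReal_sdiff hUA hU
  obtain ⟨C, hCA, hC, hC0, hC1⟩ := hπ.exists_subset_le (hA.diff hU) (by linarith)
    (sub_pos.2 hlt)
  have hun : π.real ((⋃ n, (B n).1) ∪ C) = π.real (⋃ n, (B n).1) + π.real C :=
    measureReal_union (Set.disjoint_left.2 fun x hx hxC => (hCA hxC).2 hx) hC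
  -- `D` competes at every stage, so in the limit the greedy inequality gives `π D ≤ π (⋃ B n)`,
  -- contradicting `0 < π C`.
  let D : S := ⟨(⋃ n, (B n).1) ∪ C, Set.union_subset hUA (hCA.trans Set.sdiff_subset),
    hU.union hC, by rw [hun]; linarith⟩
  have hn : ∀ n, π.real (B n).1 + π.real D.1 ≤ 2 * π.real (B (n + 1)).1 := fun n => by
    rw [hsucc]
    exact hhalf _ D ((Set.subset_iUnion (fun n => (B n).1) n).trans Set.subset_union_left)
  have := le_of_tendsto_of_tendsto' (hlim.add_const (π.real D.1))
    ((hlim.comp (Filter.tendsto_add_atTop_nat 1)).const_mul 2) hn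
  have hD : π.real D.1 = π.real (⋃ n, (B n).1) + π.real C := hun
  linarith

theorem IsAtomless.exists_measurable_forall_measureReal_eq (hπ : IsAtomless π) {ι : Type*}
    [MeasurableSpace ι] [MeasurableSingletonClass ι] (S : Finset ι) (hS : S.Nonempty) :
    ∀ (A : Set Ω) (α : ι → ℝ), MeasurableSet A → (∀ i, 0 ≤ α i) → ∑ i ∈ S, α i = π.real A →
      ∃ τ : Ω → ι, Measurable τ ∧ (∀ x, τ x ∈ S) ∧ ∀ i ∈ S, π.real (A ∩ τ ⁻¹' {i}) = α i := by
  classical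
  induction hS using Finset.Nonempty.cons_induction with
  | singleton j =>
    intro A α hA hα hsum
    refine ⟨fun _ => j, measurable_const, fun _ => by simp, fun i hi => ?_⟩
    rw [Finset.mem_singleton] at hi
    subst hi
    simpa using hsum.symm
  | cons j S hj hS ih =>
    intro A α hA hα hsum
    rw [Finset.sum_cons] at hsum
    obtain ⟨B, hBA, hB, hBj⟩ := hπ.exists_subset_measureReal_eq hA (hα j)
      (by rw [← hsum]; linarith [Finset.sum_nonneg fun i (_ : i ∈ S) => hα i])
    obtain ⟨τ, hτ, hτS, hτα⟩ := ih (A \ B) α (hA.diff hB) hα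
      (by rw [measureReal_sdiff hBA hB, hBj]; linarith)
    refine ⟨B.piecewise (fun _ => j) τ, Measurable.piecewise hB measurable_const hτ, ?_, ?_⟩
    · intro x
      by_cases hx : x ∈ B <;> simp [hx, hτS x]
    · intro i hi
      rw [Finset.mem_cons] at hi
      by_cases hij : i = j
      · subst hij
        rw [← hBj]
        congr 1
        ext x
        by_cases hx : x ∈ B
        · simp [hx, hBA hx]
        · have : τ x ≠ i := fun h => hj (h ▸ hτS x)
          simp [hx, this]
      · rw [← hτα i (hi.resolve_left hij)]
        congr 1
        ext x
        by_cases hx : x ∈ B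
        · simp [hx, Ne.symm hij]
        · simp [hx]

end Atomless

/-! ### Autonomous equations with a field Lipschitz on balls -/

section Autonomous

open Set Metric
open scoped NNReal

variable {E : Type*} [NormedAddCommGroup E] [NormedSpace ℝ E] {v : E → E}

/-- A differentiable curve solving `y' = v y` on an open interval around `0`. -/
structure IsSolution (v : E → E) (W : E) (I : Set ℝ) (φ : ℝ → E) : Prop where
  isOpen : IsOpen I
  ordConnected : I.OrdConnected
  zero_mem : (0 : ℝ) ∈ I
  initial : φ 0 = W
  hasDerivAt : ∀ t ∈ I, HasDerivAt φ (v (φ t)) t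

theorem exists_isSolution [CompleteSpace E] (hv : ∀ C : ℝ, ∃ K, LipschitzOnWith K v (closedBall 0 C))
    (W : E) : ∃ I φ, IsSolution v W I φ := by
  obtain ⟨K, hK⟩ := hv (‖W‖ + 1)
  have hK' : LipschitzOnWith K v (closedBall W ((1 : ℝ≥0) : ℝ)) := hK.mono fun x hx => by
    rw [mem_closedBall, dist_eq_norm] at hx
    rw [mem_closedBall_zero_iff]
    have h1 := norm_add_le (x - W) W
    rw [sub_add_cancel] at h1
    have h2 : ‖x - W‖ ≤ 1 := by simpa using hx
    linarith
  have hb : ∀ x ∈ closedBall W ((1 : ℝ≥0) : ℝ), ‖v x‖ ≤ ((‖v W‖₊ + K : ℝ≥0) : ℝ) := by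
    intro x hx
    have h1 := hK'.dist_le_mul x hx W (mem_closedBall_self (by simp))
    rw [mem_closedBall] at hx
    rw [dist_eq_norm] at h1
    have h2 := norm_add_le (v x - v W) (v W)
    rw [sub_add_cancel] at h2
    have h3 : (K : ℝ) * dist x W ≤ K * 1 := mul_le_mul_of_nonneg_left (by simpa using hx) K.2
    push_cast
    linarith
  -- `M` bounds the speed on the unit ball around `W`, so a curve cannot leave that ball within time
  -- `1 / (M + 1)`.
  set M : ℝ := ((‖v W‖₊ + K : ℝ≥0) : ℝ) with hM
  have hM0 : 0 ≤ M := NNReal.coe_nonneg _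
  have hε : 0 < 1 / (M + 1) := by positivity
  obtain ⟨φ, h0, hφ⟩ := (IsPicardLindelof.of_time_independent (f := v)
    (tmin := -(1 / (M + 1))) (tmax := 1 / (M + 1)) (t₀ := ⟨0, by constructor <;> linarith⟩) (r := 0)
    hb hK' (by
      simp only [sub_zero, zero_sub, neg_neg, max_self, NNReal.coe_one, NNReal.coe_zero]
      rw [← hM, mul_one_div, div_le_one (by linarith)]
      linarith)).exists_eq_forall_mem_Icc_hasDerivWithinAt₀
  exact ⟨Ioo (-(1 / (M + 1))) (1 / (M + 1)), φ, isOpen_Ioo, ordConnected_Ioo,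
    ⟨by linarith, hε⟩, h0, fun t ht => (hφ t (Ioo_subset_Icc_self ht)).hasDerivAt
      (Icc_mem_nhds ht.1 ht.2)⟩

theorem IsSolution.eqOn (hv : ∀ C : ℝ, ∃ K, LipschitzOnWith K v (closedBall 0 C)) {W : E}
    {I J : Set ℝ} {φ ψ : ℝ → E} (hφ : IsSolution v W I φ) (hψ : IsSolution v W J ψ) :
    EqOn φ ψ (I ∩ J) := by
  -- On a compact interval both curves stay in one ball, where `v` is Lipschitz; having 0 as an
  -- endpoint lets the one-sided uniqueness theorems apply.
  have main : ∀ a b : ℝ, Icc a b ⊆ I → Icc a b ⊆ J → (a = 0 ∨ b = 0) →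
      EqOn φ ψ (Icc a b) := by
    intro a b hI hJ hab
    have cφ : ContinuousOn φ (Icc a b) :=
      HasDerivAt.continuousOn fun t ht => hφ.hasDerivAt t (hI ht)
    have cψ : ContinuousOn ψ (Icc a b) :=
      HasDerivAt.continuousOn fun t ht => hψ.hasDerivAt t (hJ ht)
    obtain ⟨C, hC⟩ := isCompact_Icc.exists_bound_of_continuousOn cφ
    obtain ⟨D, hD⟩ := isCompact_Icc.exists_bound_of_continuousOn cψ
    obtain ⟨K, hK⟩ := hv (max C D)
    have bφ : ∀ t ∈ Icc a b, φ t ∈ closedBall (0 : E) (max C D) := fun t ht => by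
      simpa using Or.inl (hC t ht)
    have bψ : ∀ t ∈ Icc a b, ψ t ∈ closedBall (0 : E) (max C D) := fun t ht => by
      simpa using Or.inr (hD t ht)
    have h0 : φ 0 = ψ 0 := hφ.initial.trans hψ.initial.symm
    rcases hab with rfl | rfl
    · exact ODE_solution_unique_of_mem_Icc_right (v := fun _ => v)
        (s := fun _ => closedBall 0 (max C D)) (fun _ _ => hK) cφ
        (fun t ht => (hφ.hasDerivAt t (hI (Ico_subset_Icc_self ht))).hasDerivWithinAt)
        (fun t ht => bφ t (Ico_subset_Icc_self ht)) cψ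
        (fun t ht => (hψ.hasDerivAt t (hJ (Ico_subset_Icc_self ht))).hasDerivWithinAt)
        (fun t ht => bψ t (Ico_subset_Icc_self ht)) h0
    · exact ODE_solution_unique_of_mem_Icc_left (v := fun _ => v)
        (s := fun _ => closedBall 0 (max C D)) (fun _ _ => hK) cφ
        (fun t ht => (hφ.hasDerivAt t (hI (Ioc_subset_Icc_self ht))).hasDerivWithinAt)
        (fun t ht => bφ t (Ioc_subset_Icc_self ht)) cψ
        (fun t ht => (hψ.hasDerivAt t (hJ (Ioc_subset_Icc_self ht))).hasDerivWithinAt)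
        (fun t ht => bψ t (Ioc_subset_Icc_self ht)) h0
  intro t ht
  rcases le_total 0 t with h | h
  · exact main 0 t (hφ.ordConnected.out hφ.zero_mem ht.1) (hψ.ordConnected.out hψ.zero_mem ht.2)
      (Or.inl rfl) ⟨h, le_rfl⟩
  · exact main t 0 (hφ.ordConnected.out ht.1 hφ.zero_mem) (hψ.ordConnected.out ht.2 hψ.zero_mem)
      (Or.inr rfl) ⟨le_rfl, h⟩

/-- Any two solutions agree where both are defined, so all of them glue to one on the union of their
domains. -/
theorem exists_maximal_isSolution [CompleteSpace E]
    (hv : ∀ C : ℝ, ∃ K, LipschitzOnWith K v (closedBall 0 C)) (W : E) :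
    ∃ I φ, IsSolution v W I φ ∧ ∀ J ψ, IsSolution v W J ψ → J ⊆ I ∧ EqOn ψ φ J := by
  classical
  let A : Set (Set ℝ) := {J | ∃ ψ, IsSolution v W J ψ}
  have hmem : ∀ t ∈ ⋃₀ A, ∃ J ψ, IsSolution v W J ψ ∧ t ∈ J := by
    rintro t ⟨J, ⟨ψ, hψ⟩, ht⟩
    exact ⟨J, ψ, hψ, ht⟩
  choose! J ψ hsol hJ using hmem
  let φ : ℝ → E := fun t => ψ t t
  have hφ : ∀ K χ, IsSolution v W K χ → EqOn χ φ K := fun K χ hχ t ht =>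
    hχ.eqOn hv (hsol t ⟨K, ⟨χ, hχ⟩, ht⟩) ⟨ht, hJ t ⟨K, ⟨χ, hχ⟩, ht⟩⟩
  obtain ⟨I₀, φ₀, h₀⟩ := exists_isSolution hv W
  refine ⟨⋃₀ A, φ, ⟨?_, ?_, ?_, ?_, ?_⟩, fun K χ hχ => ⟨?_, hφ K χ hχ⟩⟩
  · exact isOpen_sUnion fun K ⟨χ, hχ⟩ => hχ.isOpen
  · exact (isPreconnected_sUnion 0 A (fun K ⟨χ, hχ⟩ => hχ.zero_mem)
      fun K ⟨χ, hχ⟩ => hχ.ordConnected.isPreconnected).ordConnected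
  · exact ⟨I₀, ⟨φ₀, h₀⟩, h₀.zero_mem⟩
  · rw [← hφ _ _ h₀ h₀.zero_mem, h₀.initial]
  · rintro t ⟨K, ⟨χ, hχ⟩, ht⟩
    rw [← hφ K χ hχ ht]
    exact (hχ.hasDerivAt t ht).congr_of_eventuallyEq
      (((hφ K χ hχ).eventuallyEq_of_mem (hχ.isOpen.mem_nhds ht)).symm)
  · exact subset_sUnion_of_mem ⟨χ, hχ⟩

end Autonomous

/-! ### Random samples from Ω^k and bounds for induced weights -/

section Sampling

variable {Ω : Type*} [MeasurableSpace Ω] (π : Measure Ω) [IsProbabilityMeasure π]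

/-- Used for projecting to a pair of coordinates, for discarding the two roots and for permuting
vertices. -/
theorem measurePreserving_comp_injective {ι κ : Type*} [Fintype ι] [Fintype κ] {f : ι → κ}
    (hf : f.Injective) :
    MeasurePreserving (fun z : κ → Ω => z ∘ f) (Measure.pi fun _ => π) (Measure.pi fun _ => π) := by
  have hm : Measurable fun z : κ → Ω => z ∘ f :=
    measurable_pi_lambda _ fun i => measurable_pi_apply (f i)
  refine ⟨hm, (Measure.pi_eq fun s hs => ?_).symm⟩
  have hpre : (fun z : κ → Ω => z ∘ f) ⁻¹' Set.pi Set.univ s =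
      Set.pi Set.univ (Function.extend f s fun _ => Set.univ) := by
    ext z
    simp only [Set.mem_preimage, Set.mem_univ_pi, Function.comp_apply]
    constructor
    · intro h j
      by_cases hj : ∃ i, f i = j
      · obtain ⟨i, rfl⟩ := hj
        rw [hf.extend_apply]
        exact h i
      · rw [Function.extend_apply' _ _ _ hj]
        trivial
    · intro h i
      simpa [hf.extend_apply] using h (f i)
  rw [Measure.map_apply hm (MeasurableSet.univ_pi hs), hpre, Measure.pi_pi]
  refine (Finset.prod_of_injOn f hf.injOn (by simp) (fun j _ hj => ?_) fun i _ => ?_).symm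
  · rw [Function.extend_apply' _ _ _ (by simpa using hj), measure_univ]
  · rw [hf.extend_apply]

theorem measurePreserving_eval_pair {κ : Type*} [Fintype κ] {i j : κ} (hij : i ≠ j) :
    MeasurePreserving (fun p : κ → Ω => (p i, p j)) (Measure.pi fun _ => π) (π.prod π) := by
  have hinj : Function.Injective ![i, j] := by
    intro x y h
    fin_cases x <;> fin_cases y <;> simp_all [eq_comm]
  exact (measurePreserving_finTwoArrow π).comp (measurePreserving_comp_injective π hinj)

variable {k : ℕ}

/-- The point `z` with its coordinates `a` and `b` replaced by those of a pair. -/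
def rooted (a b : Fin k) (q : (Ω × Ω) × (Fin k → Ω)) (i : Fin k) : Ω :=
  if i = a then q.1.1 else if i = b then q.1.2 else q.2 i

/-- Overwriting coordinates `a`, `b` by an independent pair leaves the product law unchanged.
Keeping the two dummy coordinates makes the integration space independent of the roots. -/
theorem measurePreserving_rooted {a b : Fin k} (hab : a ≠ b) :
    MeasurePreserving (rooted (Ω := Ω) a b) ((π.prod π).prod (Measure.pi fun _ => π))
      (Measure.pi fun _ => π) := by
  have hm : Measurable (rooted (Ω := Ω) a b) := by
    refine measurable_pi_lambda _ fun i => ?_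
    unfold rooted
    split_ifs
    · fun_prop
    · fun_prop
    · fun_prop
  refine ⟨hm, (Measure.pi_eq fun s hs => ?_).symm⟩
  have hpre : rooted (Ω := Ω) a b ⁻¹' Set.pi Set.univ s =
      (s a ×ˢ s b) ×ˢ
        Set.pi Set.univ fun i => if i = a then Set.univ else if i = b then Set.univ else s i := by
    ext ⟨⟨x, y⟩, z⟩
    simp only [rooted, Set.mem_preimage, Set.mem_univ_pi, Set.mem_prod]
    constructor
    · intro h
      refine ⟨⟨by simpa using h a, by simpa [hab.symm] using h b⟩, fun i => ?_⟩
      have := h i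
      split_ifs at this ⊢ <;> simp_all
    · rintro ⟨⟨hx, hy⟩, hz⟩ i
      have := hz i
      split_ifs at this ⊢ <;> simp_all
  rw [Measure.map_apply hm (MeasurableSet.univ_pi hs), hpre, Measure.prod_prod, Measure.prod_prod,
    Measure.pi_pi, ← Finset.mul_prod_erase Finset.univ (fun i => π (s i)) (Finset.mem_univ a),
    ← Finset.mul_prod_erase (Finset.univ.erase a) (fun i => π (s i)) (a := b) (by simp [hab.symm]),
    ← Finset.mul_prod_erase Finset.univ _ (Finset.mem_univ a),
    ← Finset.mul_prod_erase (Finset.univ.erase a) _ (a := b) (by simp [hab.symm])]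
  simp only [if_true, measure_univ, one_mul, if_neg hab.symm, mul_assoc]
  congr 2
  refine Finset.prod_congr rfl fun i hi => ?_
  simp only [Finset.mem_erase] at hi
  simp [hi.1, hi.2.1]

variable {π}

/-- Distinctness is needed: `(p i, p i)` lies on the diagonal, which may be a null set. -/
theorem ae_forall_pair {P : Ω × Ω → Prop} (h : ∀ᵐ e ∂(π.prod π), P e) :
    ∀ᵐ p ∂(Measure.pi fun _ : Fin k => π), ∀ i j, i ≠ j → P (p i, p j) := by
  rw [ae_all_iff]
  intro i
  rw [ae_all_iff]
  intro j
  by_cases hij : i = j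
  · simp [hij]
  · filter_upwards [(measurePreserving_eval_pair π hij).quasiMeasurePreserving.ae h] with p hp _
    exact hp

theorem ae_ae_rooted {a b : Fin k} (hab : a ≠ b) {P : (Fin k → Ω) → Prop}
    (h : ∀ᵐ p ∂(Measure.pi fun _ : Fin k => π), P p) :
    ∀ᵐ e ∂(π.prod π), ∀ᵐ z ∂(Measure.pi fun _ : Fin k => π), P (rooted a b (e, z)) :=
  Measure.ae_ae_of_ae_prod ((measurePreserving_rooted π hab).quasiMeasurePreserving.ae h)

open Classical in
/-- The weight with which the graph `F` is induced on a point of `Ω^k` by the function `U`. -/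
noncomputable def inducedWeight (F : SimpleGraph (Fin k)) (U : Ω × Ω → ℝ) (p : Fin k → Ω) : ℝ :=
  ∏ e : Fin k × Fin k with e.1 < e.2,
    if F.Adj e.1 e.2 then U (p e.1, p e.2) else 1 - U (p e.1, p e.2)

theorem measurable_inducedWeight (F : SimpleGraph (Fin k)) {U : Ω × Ω → ℝ} (hU : Measurable U) :
    Measurable (inducedWeight F U) := by
  classical
  unfold inducedWeight
  refine Finset.measurable_prod _ fun e _ => ?_
  have : Measurable fun p : Fin k → Ω => U (p e.1, p e.2) := hU.comp (by fun_prop)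
  split_ifs
  · exact this
  · exact this.const_sub 1

theorem rootedDensity_eq (F : SimpleGraph (Fin k)) (a b : Fin k) {U : Ω × Ω → ℝ}
    (hU : Measurable U) (e : Ω × Ω) :
    rootedDensity π F a b U e.1 e.2 =
      ∫ z, inducedWeight F U (rooted a b (e, z)) ∂(Measure.pi fun _ : Fin k => π) := by
  have hm := measurePreserving_comp_injective (ι := {i : Fin k // i ≠ a ∧ i ≠ b}) π
    Subtype.val_injective
  have hr : Measurable fun z : {i : Fin k // i ≠ a ∧ i ≠ b} → Ω => rootedPoint a b e.1 e.2 z := by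
    refine measurable_pi_lambda _ fun i => ?_
    unfold rootedPoint
    split_ifs
    · fun_prop
    · fun_prop
    · exact measurable_pi_apply _
  unfold rootedDensity
  rw [← hm.map_eq]
  refine (integral_map (f := fun z => inducedWeight F U (rootedPoint a b e.1 e.2 z))
    hm.measurable.aemeasurable
    ((measurable_inducedWeight F hU).comp hr).aestronglyMeasurable).trans ?_
  refine integral_congr_ae (Filter.Eventually.of_forall fun z => ?_)
  have : rootedPoint a b e.1 e.2 (z ∘ Subtype.val) = rooted a b (e, z) := by
    funext i
    simp [rootedPoint, rooted]
  simp only [this]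

theorem abs_integral_le_of_ae {f : Ω → ℝ} {C : ℝ}
    (h : ∀ᵐ x ∂π, |f x| ≤ C) : |∫ x, f x ∂π| ≤ C := by
  simpa using norm_integral_le_of_norm_le_const (f := f) h

theorem abs_prod_le_pow_card {ι : Type*} (s : Finset ι) {g : ι → ℝ} {M : ℝ}
    (hg : ∀ i ∈ s, |g i| ≤ M) : |∏ i ∈ s, g i| ≤ M ^ s.card := by
  rw [Finset.abs_prod]
  exact (Finset.prod_le_prod (fun _ _ => abs_nonneg _) hg).trans_eq (Finset.prod_const M)

/-- Telescoping, replacing one factor at a time. -/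
theorem abs_prod_sub_prod_le {ι : Type*} (s : Finset ι) {f g : ι → ℝ} {M δ : ℝ} (hM : 1 ≤ M)
    (hf : ∀ i ∈ s, |f i| ≤ M) (hg : ∀ i ∈ s, |g i| ≤ M) (hfg : ∀ i ∈ s, |f i - g i| ≤ δ) :
    |∏ i ∈ s, f i - ∏ i ∈ s, g i| ≤ s.card * M ^ s.card * δ := by
  classical
  induction s using Finset.induction_on with
  | empty => simp
  | insert j s hj ih =>
    have hδ : 0 ≤ δ := (abs_nonneg _).trans (hfg j (Finset.mem_insert_self j s))
    have ih' := ih (fun i hi => hf i (Finset.mem_insert_of_mem hi))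
      (fun i hi => hg i (Finset.mem_insert_of_mem hi))
      fun i hi => hfg i (Finset.mem_insert_of_mem hi)
    have hgs : |∏ i ∈ s, g i| ≤ M ^ s.card :=
      abs_prod_le_pow_card s fun i hi => hg i (Finset.mem_insert_of_mem hi)
    have hpow : M ^ s.card ≤ M ^ s.card * M := le_mul_of_one_le_right (by positivity) hM
    rw [Finset.prod_insert hj, Finset.prod_insert hj, Finset.card_insert_of_notMem hj]
    calc |f j * ∏ i ∈ s, f i - g j * ∏ i ∈ s, g i|
        = |f j * (∏ i ∈ s, f i - ∏ i ∈ s, g i) + (f j - g j) * ∏ i ∈ s, g i| := by ring_nf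
      _ ≤ |f j| * |∏ i ∈ s, f i - ∏ i ∈ s, g i| + |f j - g j| * |∏ i ∈ s, g i| := by
        rw [← abs_mul, ← abs_mul]; exact abs_add_le _ _
      _ ≤ M * (s.card * M ^ s.card * δ) + δ * (M ^ s.card * M) := by
        have := hf j (Finset.mem_insert_self j s)
        have := hfg j (Finset.mem_insert_self j s)
        have := hgs.trans hpow
        gcongr
      _ = _ := by push_cast; ring

variable (k) in
/-- A bound for the induced weights of functions bounded by `C`. -/
noncomputable def weightBound (C : ℝ) : ℝ :=
  (1 + C) ^ (Finset.univ.filter fun e : Fin k × Fin k => e.1 < e.2).card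

theorem weightBound_nonneg {C : ℝ} (hC : 0 ≤ C) : 0 ≤ weightBound k C := by
  unfold weightBound; positivity

omit [MeasurableSpace Ω] in
theorem abs_inducedWeight_le (F : SimpleGraph (Fin k)) {U : Ω × Ω → ℝ} {p : Fin k → Ω} {C : ℝ}
    (h : ∀ i j, i ≠ j → |U (p i, p j)| ≤ C) : |inducedWeight F U p| ≤ weightBound k C := by
  classical
  unfold inducedWeight weightBound
  refine abs_prod_le_pow_card _ fun e he => ?_
  have := abs_le.1 (h e.1 e.2 (Finset.mem_filter.1 he).2.ne)
  split_ifs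
  · exact abs_le.2 ⟨by linarith, by linarith⟩
  · exact abs_le.2 ⟨by linarith, by linarith⟩

variable (k) in
/-- A Lipschitz constant for the induced weights of functions bounded by `C`. -/
noncomputable def weightLip (C : ℝ) : ℝ :=
  (Finset.univ.filter fun e : Fin k × Fin k => e.1 < e.2).card * weightBound k C

theorem weightLip_nonneg {C : ℝ} (hC : 0 ≤ C) : 0 ≤ weightLip k C :=
  mul_nonneg (Nat.cast_nonneg _) (weightBound_nonneg hC)

omit [MeasurableSpace Ω] in
theorem abs_inducedWeight_sub_le (F : SimpleGraph (Fin k)) {U V : Ω × Ω → ℝ} {p : Fin k → Ω}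
    {C δ : ℝ} (hC : 0 ≤ C) (hU : ∀ i j, i ≠ j → |U (p i, p j)| ≤ C)
    (hV : ∀ i j, i ≠ j → |V (p i, p j)| ≤ C)
    (hUV : ∀ i j, i ≠ j → |U (p i, p j) - V (p i, p j)| ≤ δ) :
    |inducedWeight F U p - inducedWeight F V p| ≤ weightLip k C * δ := by
  classical
  unfold inducedWeight weightLip weightBound
  refine abs_prod_sub_prod_le _ (by linarith) (fun e he => ?_) (fun e he => ?_) fun e he => ?_
  · have := abs_le.1 (hU e.1 e.2 (Finset.mem_filter.1 he).2.ne)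
    split_ifs
    · exact abs_le.2 ⟨by linarith, by linarith⟩
    · exact abs_le.2 ⟨by linarith, by linarith⟩
  · have := abs_le.1 (hV e.1 e.2 (Finset.mem_filter.1 he).2.ne)
    split_ifs
    · exact abs_le.2 ⟨by linarith, by linarith⟩
    · exact abs_le.2 ⟨by linarith, by linarith⟩
  · have := hUV e.1 e.2 (Finset.mem_filter.1 he).2.ne
    split_ifs
    · exact this
    · rw [abs_sub_comm] at this
      convert this using 2
      ring

end Sampling

/-! ### Regularity of the velocity operator -/

section Velocity

variable {Ω : Type*} [MeasurableSpace Ω] {π : Measure Ω} [IsProbabilityMeasure π] {k : ℕ}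

theorem measurable_rooted_right (a b : Fin k) (e : Ω × Ω) :
    Measurable fun z : Fin k → Ω => rooted a b (e, z) := by
  refine measurable_pi_lambda _ fun i => ?_
  unfold rooted
  split_ifs
  · fun_prop
  · fun_prop
  · fun_prop

theorem measurable_rootedDensity (F : SimpleGraph (Fin k)) {a b : Fin k} (hab : a ≠ b)
    {U : Ω × Ω → ℝ} (hU : Measurable U) :
    Measurable fun e : Ω × Ω => rootedDensity π F a b U e.1 e.2 := by
  simp only [rootedDensity_eq F a b hU]
  exact (StronglyMeasurable.integral_prod_right'
    ((measurable_inducedWeight F hU).comp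
      (measurePreserving_rooted π hab).measurable).stronglyMeasurable).measurable

theorem ae_integrable_inducedWeight (F : SimpleGraph (Fin k)) {a b : Fin k} (hab : a ≠ b)
    {U : Ω × Ω → ℝ} (hU : Measurable U) {C : ℝ} (hC : ∀ᵐ e ∂(π.prod π), |U e| ≤ C) :
    ∀ᵐ e ∂(π.prod π), Integrable (fun z => inducedWeight F U (rooted a b (e, z)))
      (Measure.pi fun _ : Fin k => π) := by
  filter_upwards [ae_ae_rooted hab (ae_forall_pair hC)] with e he
  refine Integrable.of_bound (C := weightBound k C)
    ((measurable_inducedWeight F hU).comp (measurable_rooted_right a b e)).aestronglyMeasurable ?_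
  filter_upwards [he] with z hz
  exact abs_inducedWeight_le F hz

theorem ae_abs_rootedDensity_le (F : SimpleGraph (Fin k)) {a b : Fin k} (hab : a ≠ b)
    {U : Ω × Ω → ℝ} (hU : Measurable U) {C : ℝ} (hC : ∀ᵐ e ∂(π.prod π), |U e| ≤ C) :
    ∀ᵐ e ∂(π.prod π), |rootedDensity π F a b U e.1 e.2| ≤ weightBound k C := by
  filter_upwards [ae_ae_rooted hab (ae_forall_pair hC)] with e he
  rw [rootedDensity_eq F a b hU]
  refine abs_integral_le_of_ae ?_
  filter_upwards [he] with z hz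
  exact abs_inducedWeight_le F hz

theorem ae_abs_rootedDensity_sub_le (F : SimpleGraph (Fin k)) {a b : Fin k} (hab : a ≠ b)
    {U V : Ω × Ω → ℝ} (hU : Measurable U) (hV : Measurable V) {C δ : ℝ} (hC0 : 0 ≤ C)
    (hUC : ∀ᵐ e ∂(π.prod π), |U e| ≤ C) (hVC : ∀ᵐ e ∂(π.prod π), |V e| ≤ C)
    (hUV : ∀ᵐ e ∂(π.prod π), |U e - V e| ≤ δ) :
    ∀ᵐ e ∂(π.prod π),
      |rootedDensity π F a b U e.1 e.2 - rootedDensity π F a b V e.1 e.2| ≤ weightLip k C * δ := by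
  filter_upwards [ae_ae_rooted hab (ae_forall_pair hUC), ae_ae_rooted hab (ae_forall_pair hVC),
    ae_ae_rooted hab (ae_forall_pair hUV), ae_integrable_inducedWeight F hab hU hUC,
    ae_integrable_inducedWeight F hab hV hVC] with e h1 h2 h3 i1 i2
  rw [rootedDensity_eq F a b hU, rootedDensity_eq F a b hV, ← integral_sub i1 i2]
  refine abs_integral_le_of_ae ?_
  filter_upwards [h1, h2, h3] with z h1 h2 h3
  exact abs_inducedWeight_sub_le F hC0 h1 h2 h3

theorem rootedDensity_swap (F : SimpleGraph (Fin k)) {a b : Fin k} (hab : a ≠ b)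
    {U : Ω × Ω → ℝ} (hU : Measurable U) (e : Ω × Ω) :
    rootedDensity π F a b U e.swap.1 e.swap.2 = rootedDensity π F b a U e.1 e.2 := by
  rw [rootedDensity_eq F a b hU, rootedDensity_eq F b a hU]
  congr 1
  funext z
  congr 1
  funext i
  unfold rooted
  split_ifs with h1 h2
  · exact absurd (h1.symm.trans h2) hab
  · rfl
  · rfl
  · rfl

open Classical in
/-- The expected change of the pair `a b` when the rule `R` is applied to the graph `F`. -/
noncomputable def Rule.drift (R : Rule k) (F : SimpleGraph (Fin k)) (a b : Fin k) : ℝ :=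
  (∑ H : SimpleGraph (Fin k), R.prob F H * (if H.Adj a b then 1 else 0)) -
    (if F.Adj a b then 1 else 0)

theorem Rule.drift_comm (R : Rule k) (F : SimpleGraph (Fin k)) (a b : Fin k) :
    R.drift F a b = R.drift F b a := by
  have h : ∀ G : SimpleGraph (Fin k), G.Adj a b = G.Adj b a := fun G => propext (G.adj_comm a b)
  rw [Rule.drift, Rule.drift, h F]
  congr 1
  exact Finset.sum_congr rfl fun H _ => by rw [h H]

omit [IsProbabilityMeasure π] in
open Classical in
theorem velocity_eq (R : Rule k) (U : Ω × Ω → ℝ) (e : Ω × Ω) :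
    velocity π R U e = ∑ F : SimpleGraph (Fin k), ∑ r : Fin k × Fin k with r.1 ≠ r.2,
      rootedDensity π F r.1 r.2 U e.1 e.2 * R.drift F r.1 r.2 := rfl

theorem measurable_velocity (R : Rule k) {U : Ω × Ω → ℝ} (hU : Measurable U) :
    Measurable (velocity π R U) := by
  classical
  unfold velocity
  refine Finset.measurable_sum _ fun F _ => Finset.measurable_sum _ fun r hr => ?_
  exact (measurable_rootedDensity F (by simpa using hr) hU).mul_const _

theorem velocity_swap (R : Rule k) {U : Ω × Ω → ℝ} (hU : Measurable U) (e : Ω × Ω) :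
    velocity π R U e.swap = velocity π R U e := by
  classical
  rw [velocity_eq, velocity_eq]
  refine Finset.sum_congr rfl fun F _ => ?_
  refine Finset.sum_nbij' Prod.swap Prod.swap ?_ ?_ ?_ ?_ ?_
  · simp +contextual [eq_comm]
  · simp +contextual [eq_comm]
  · simp
  · simp
  · intro r hr
    rw [rootedDensity_swap F (by simpa using hr) hU, R.drift_comm]
    rfl

open Classical in
/-- A bound for all the coefficients of the velocity operator of `R`, summed up. -/
noncomputable def Rule.totalDrift (R : Rule k) : ℝ :=
  ∑ F : SimpleGraph (Fin k), ∑ r : Fin k × Fin k with r.1 ≠ r.2, |R.drift F r.1 r.2|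

theorem Rule.totalDrift_nonneg (R : Rule k) : 0 ≤ R.totalDrift :=
  Finset.sum_nonneg fun _ _ => Finset.sum_nonneg fun _ _ => abs_nonneg _

omit [IsProbabilityMeasure π] in
theorem ae_forall_root {P : SimpleGraph (Fin k) → Fin k → Fin k → Ω × Ω → Prop}
    (h : ∀ F a b, a ≠ b → ∀ᵐ e ∂(π.prod π), P F a b e) :
    ∀ᵐ e ∂(π.prod π), ∀ F a b, a ≠ b → P F a b e := by
  simp only [ae_all_iff]
  exact h

theorem ae_abs_velocity_le (R : Rule k) {U : Ω × Ω → ℝ} (hU : Measurable U) {C : ℝ}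
    (hC : ∀ᵐ e ∂(π.prod π), |U e| ≤ C) :
    ∀ᵐ e ∂(π.prod π), |velocity π R U e| ≤ weightBound k C * R.totalDrift := by
  classical
  filter_upwards [ae_forall_root fun F a b hab => ae_abs_rootedDensity_le F hab hU hC] with e he
  rw [velocity_eq, Rule.totalDrift, Finset.mul_sum]
  refine (Finset.abs_sum_le_sum_abs _ _).trans (Finset.sum_le_sum fun F _ => ?_)
  rw [Finset.mul_sum]
  refine (Finset.abs_sum_le_sum_abs _ _).trans ?_
  refine Finset.sum_le_sum fun r hr => ?_
  rw [abs_mul]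
  exact mul_le_mul_of_nonneg_right (he F r.1 r.2 (by simpa using hr)) (abs_nonneg _)

theorem ae_abs_velocity_sub_le (R : Rule k) {U V : Ω × Ω → ℝ} (hU : Measurable U)
    (hV : Measurable V) {C δ : ℝ} (hC0 : 0 ≤ C)
    (hUC : ∀ᵐ e ∂(π.prod π), |U e| ≤ C) (hVC : ∀ᵐ e ∂(π.prod π), |V e| ≤ C)
    (hUV : ∀ᵐ e ∂(π.prod π), |U e - V e| ≤ δ) :
    ∀ᵐ e ∂(π.prod π),
      |velocity π R U e - velocity π R V e| ≤ weightLip k C * δ * R.totalDrift := by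
  classical
  filter_upwards [ae_forall_root fun F a b hab =>
    ae_abs_rootedDensity_sub_le F hab hU hV hC0 hUC hVC hUV] with e he
  rw [velocity_eq, velocity_eq, Rule.totalDrift, Finset.mul_sum, ← Finset.sum_sub_distrib]
  refine (Finset.abs_sum_le_sum_abs _ _).trans (Finset.sum_le_sum fun F _ => ?_)
  rw [Finset.mul_sum, ← Finset.sum_sub_distrib]
  refine (Finset.abs_sum_le_sum_abs _ _).trans ?_
  refine Finset.sum_le_sum fun r hr => ?_
  rw [← sub_mul, abs_mul]
  exact mul_le_mul_of_nonneg_right (he F r.1 r.2 (by simpa using hr)) (abs_nonneg _)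

/-- The Lipschitz estimate with `δ = 0`. -/
theorem velocity_congr_ae (R : Rule k) {U V : Ω × Ω → ℝ} (hU : Measurable U)
    (hV : Measurable V) {C : ℝ} (hUC : ∀ᵐ e ∂(π.prod π), |U e| ≤ C) (h : U =ᵐ[π.prod π] V) :
    velocity π R U =ᵐ[π.prod π] velocity π R V := by
  have hC : ∀ᵐ e ∂(π.prod π), |U e| ≤ |C| := hUC.mono fun e he => he.trans (le_abs_self C)
  filter_upwards [ae_abs_velocity_sub_le (δ := 0) R hU hV (abs_nonneg C) hC
    (by filter_upwards [h, hC] with e h1 h2; rwa [← h1])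
    (by filter_upwards [h] with e h1; simp [h1])] with e he
  rw [mul_zero, zero_mul] at he
  exact sub_eq_zero.1 (abs_eq_zero.1 (he.antisymm (abs_nonneg _)))

end Velocity

/-! ### The velocity as a vector field on kernels -/

section Kernels

variable {Ω : Type*} [MeasurableSpace Ω] {π : Measure Ω} [IsProbabilityMeasure π] {k : ℕ}

instance : CompleteSpace (kernels π) := by
  have hs : MeasurePreserving Prod.swap (π.prod π) (π.prod π) := Measure.measurePreserving_swap
  -- Kernels are the fixed points of an isometry, hence closed in a complete space.
  have h : (kernels π : Set (Lp ℝ ∞ (π.prod π))) =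
      {W | Lp.compMeasurePreserving Prod.swap hs W = W} := by
    ext W
    rw [Set.mem_ofPred_eq, Lp.ext_iff]
    have := Lp.coeFn_compMeasurePreserving W hs
    constructor
    · intro h
      exact this.trans h
    · intro h
      exact this.symm.trans h
  have hc : IsClosed (kernels π : Set (Lp ℝ ∞ (π.prod π))) := by
    rw [h]
    exact isClosed_eq (Lp.isometry_compMeasurePreserving hs).continuous continuous_id
  exact hc.completeSpace_coe

omit [IsProbabilityMeasure π] in
theorem ae_abs_le_norm (W : Lp ℝ ∞ (π.prod π)) : ∀ᵐ e ∂(π.prod π), |W e| ≤ ‖W‖ := by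
  have h := enorm_ae_le_eLpNormEssSup (W : Ω × Ω → ℝ) (π.prod π)
  filter_upwards [h] with e he
  rw [← eLpNorm_exponent_top] at he
  rw [Lp.norm_def, ← Real.norm_eq_abs, ← toReal_enorm]
  exact ENNReal.toReal_mono (Lp.eLpNorm_ne_top W) he

omit [IsProbabilityMeasure π] in
theorem measurable_coeFn (W : Lp ℝ ∞ (π.prod π)) : Measurable (W : Ω × Ω → ℝ) :=
  (Lp.stronglyMeasurable W).measurable

theorem exists_kernel_ae_eq {U : Ω × Ω → ℝ} (hU : Measurable U) {C : ℝ}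
    (hC : ∀ᵐ e ∂(π.prod π), |U e| ≤ C) (hs : ∀ e, U e.swap = U e) :
    ∃ W : kernels π, ((W : Lp ℝ ∞ (π.prod π)) : Ω × Ω → ℝ) =ᵐ[π.prod π] U := by
  have hm : MemLp U ∞ (π.prod π) := memLp_top_of_bound hU.aestronglyMeasurable C hC
  have h1 := hm.coeFn_toLp
  have h2 := (Measure.measurePreserving_swap (μ := π) (ν := π)).quasiMeasurePreserving.ae h1
  refine ⟨⟨hm.toLp U, ?_⟩, h1⟩
  change (fun p : Ω × Ω => hm.toLp U p.swap) =ᵐ[π.prod π] hm.toLp U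
  filter_upwards [h1, h2] with e h1 h2
  rw [h1, h2, hs]

theorem exists_kernel_velocity (R : Rule k) (W : kernels π) :
    ∃ V : kernels π, ((V : Lp ℝ ∞ (π.prod π)) : Ω × Ω → ℝ) =ᵐ[π.prod π]
      velocity π R ((W : Lp ℝ ∞ (π.prod π)) : Ω × Ω → ℝ) :=
  exists_kernel_ae_eq (measurable_velocity R (measurable_coeFn _))
    (ae_abs_velocity_le R (measurable_coeFn _) (ae_abs_le_norm _))
    (velocity_swap R (measurable_coeFn _))

/-- The velocity operator as a vector field on the space of kernels. -/
noncomputable def kernelVelocity (R : Rule k) (W : kernels π) : kernels π :=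
  (exists_kernel_velocity R W).choose

theorem coeFn_kernelVelocity (R : Rule k) (W : kernels π) :
    ((kernelVelocity R W : Lp ℝ ∞ (π.prod π)) : Ω × Ω → ℝ) =ᵐ[π.prod π]
      velocity π R ((W : Lp ℝ ∞ (π.prod π)) : Ω × Ω → ℝ) :=
  (exists_kernel_velocity R W).choose_spec

theorem lipschitzOnWith_kernelVelocity (R : Rule k) (C : ℝ) :
    ∃ K, LipschitzOnWith K (kernelVelocity (π := π) R) (Metric.closedBall 0 C) := by
  have h0 : 0 ≤ weightLip k |C| * R.totalDrift :=
    mul_nonneg (weightLip_nonneg (abs_nonneg C)) R.totalDrift_nonneg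
  refine ⟨NNReal.mk _ h0, LipschitzOnWith.of_dist_le_mul fun W hW V hV => ?_⟩
  rw [mem_closedBall_zero_iff] at hW hV
  rw [dist_eq_norm, dist_eq_norm, NNReal.coe_mk]
  change ‖((kernelVelocity R W - kernelVelocity R V : kernels π) : Lp ℝ ∞ (π.prod π))‖ ≤ _
  refine (Lp.norm_le_of_ae_bound (C := weightLip k |C| * R.totalDrift * ‖W - V‖)
    (mul_nonneg h0 (norm_nonneg _)) ?_).trans (by simp)
  have hWC : ∀ᵐ e ∂(π.prod π), |(W : Lp ℝ ∞ (π.prod π)) e| ≤ |C| :=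
    (ae_abs_le_norm _).mono fun e he => he.trans (hW.trans (le_abs_self C))
  have hVC : ∀ᵐ e ∂(π.prod π), |(V : Lp ℝ ∞ (π.prod π)) e| ≤ |C| :=
    (ae_abs_le_norm _).mono fun e he => he.trans (hV.trans (le_abs_self C))
  have hWV : ∀ᵐ e ∂(π.prod π),
      |(W : Lp ℝ ∞ (π.prod π)) e - (V : Lp ℝ ∞ (π.prod π)) e| ≤ ‖W - V‖ := by
    filter_upwards [ae_abs_le_norm ((W - V : kernels π) : Lp ℝ ∞ (π.prod π)),
      Lp.coeFn_sub (W : Lp ℝ ∞ (π.prod π)) (V : Lp ℝ ∞ (π.prod π))] with e h1 h2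
    rw [Submodule.coe_sub, h2] at h1
    exact h1
  filter_upwards [ae_abs_velocity_sub_le R (measurable_coeFn _) (measurable_coeFn _)
    (abs_nonneg C) hWC hVC hWV, coeFn_kernelVelocity R W, coeFn_kernelVelocity R V,
    Lp.coeFn_sub (kernelVelocity R W : Lp ℝ ∞ (π.prod π)) (kernelVelocity R V)] with e h1 h2 h3 h4
  rw [Submodule.coe_sub, h4, Pi.sub_apply, h2, h3, Real.norm_eq_abs]
  linarith

theorem isTrajectory_iff (R : Rule k) (W : kernels π) (I : Set ℝ) (φ : ℝ → kernels π) :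
    IsTrajectory π R W I φ ↔ IsSolution (kernelVelocity R) W I φ := by
  constructor
  · rintro ⟨h1, h2, h3, h4, h5⟩
    refine ⟨h1, h2, h3, h4, fun t ht => ?_⟩
    obtain ⟨V, hV, hV'⟩ := h5 t ht
    have : V = kernelVelocity R (φ t) :=
      Subtype.ext (Lp.ext (hV'.trans (coeFn_kernelVelocity R (φ t)).symm))
    rwa [← this]
  · rintro ⟨h1, h2, h3, h4, h5⟩
    exact ⟨h1, h2, h3, h4, fun t ht => ⟨_, h5 t ht, coeFn_kernelVelocity R (φ t)⟩⟩

theorem exists_isMaximalTrajectory (R : Rule k) (W : kernels π) :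
    ∃ I φ, IsMaximalTrajectory π R W I φ := by
  simpa only [IsMaximalTrajectory, isTrajectory_iff] using
    exists_maximal_isSolution (lipschitzOnWith_kernelVelocity R) W

/-- Two rules have the same trajectories if and only if they have the same velocities. -/
theorem haveSameTrajectories_iff (R R' : Rule k) :
    HaveSameTrajectories π R R' ↔ kernelVelocity (π := π) R = kernelVelocity R' := by
  constructor
  · intro h
    funext W
    obtain ⟨I, φ, ⟨h1, -⟩, ⟨h2, -⟩⟩ := h W
    rw [isTrajectory_iff] at h1 h2
    -- The common trajectory has only one derivative at time 0, and it is the velocity of both rules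
    -- at `W`.
    have := (h1.hasDerivAt 0 h1.zero_mem).unique (h2.hasDerivAt 0 h1.zero_mem)
    rwa [h1.initial] at this
  · intro h W
    obtain ⟨I, φ, hφ⟩ := exists_isMaximalTrajectory R W
    refine ⟨I, φ, hφ, ?_⟩
    simpa only [IsMaximalTrajectory, isTrajectory_iff, h] using hφ

theorem velocity_ae_eq_of_kernelVelocity_eq {R R' : Rule k}
    (h : kernelVelocity (π := π) R = kernelVelocity R') {U : Ω × Ω → ℝ} (hU : Measurable U) {C : ℝ}
    (hC : ∀ᵐ e ∂(π.prod π), |U e| ≤ C) (hs : ∀ e, U e.swap = U e) :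
    velocity π R U =ᵐ[π.prod π] velocity π R' U := by
  obtain ⟨W, hW⟩ := exists_kernel_ae_eq hU hC hs
  have h1 := velocity_congr_ae R hU (measurable_coeFn _) hC hW.symm
  have h2 := velocity_congr_ae R' hU (measurable_coeFn _) hC hW.symm
  have h3 := coeFn_kernelVelocity R W
  rw [h] at h3
  exact h1.trans (h3.symm.trans ((coeFn_kernelVelocity R' W).trans h2.symm))

end Kernels

/-! ### Testing velocities on step kernels -/

section StepKernels

variable {Ω : Type*} [MeasurableSpace Ω] {π : Measure Ω} [IsProbabilityMeasure π] {k : ℕ}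

/-- By Fubini, integrating over the roots and then over the other vertices is integrating over a
full sample. -/
theorem integral_mul_rootedDensity (F : SimpleGraph (Fin k)) {a b : Fin k} (hab : a ≠ b)
    {U g : Ω × Ω → ℝ} (hU : Measurable U) (hg : Measurable g) {C D : ℝ} (hC : ∀ e, |U e| ≤ C)
    (hD : ∀ e, |g e| ≤ D) :
    ∫ e, g e * rootedDensity π F a b U e.1 e.2 ∂(π.prod π) =
      ∫ p, g (p a, p b) * inducedWeight F U p ∂(Measure.pi fun _ : Fin k => π) := by
  have hmp := measurePreserving_rooted π hab
  have hm : Measurable fun p : Fin k → Ω => g (p a, p b) * inducedWeight F U p :=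
    (hg.comp (by fun_prop)).mul (measurable_inducedWeight F hU)
  have hint : Integrable (fun p : Fin k → Ω => g (p a, p b) * inducedWeight F U p)
      (Measure.pi fun _ => π) :=
    Integrable.of_bound (C := D * weightBound k C) hm.aestronglyMeasurable
      (Filter.Eventually.of_forall fun p => by
        rw [Real.norm_eq_abs, abs_mul]
        exact mul_le_mul (hD _) (abs_inducedWeight_le F fun i j _ => hC _) (abs_nonneg _)
          ((abs_nonneg _).trans (hD (p a, p b))))
  have hint' := (hmp.integrable_comp hm.aestronglyMeasurable).2 hint
  calc _ = ∫ e, ∫ z, g (rooted a b (e, z) a, rooted a b (e, z) b) *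
        inducedWeight F U (rooted a b (e, z)) ∂(Measure.pi fun _ : Fin k => π) ∂(π.prod π) := by
        refine integral_congr_ae (Filter.Eventually.of_forall fun e => ?_)
        simp only
        rw [rootedDensity_eq F a b hU, ← integral_const_mul]
        simp [rooted, hab.symm]
    _ = ∫ q, g (rooted a b q a, rooted a b q b) * inducedWeight F U (rooted a b q)
          ∂((π.prod π).prod (Measure.pi fun _ : Fin k => π)) := (integral_prod _ hint').symm
    _ = _ := by
        refine (integral_map (f := fun p : Fin k → Ω => g (p a, p b) * inducedWeight F U p)
          hmp.measurable.aemeasurable ?_).symm.trans (by rw [hmp.map_eq])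
        exact hm.aestronglyMeasurable

open Classical in
theorem integral_mul_velocity (R : Rule k) {U g : Ω × Ω → ℝ} (hU : Measurable U)
    (hg : Measurable g) {C D : ℝ} (hC : ∀ e, |U e| ≤ C) (hD : ∀ e, |g e| ≤ D) :
    ∫ e, g e * velocity π R U e ∂(π.prod π) =
      ∑ F : SimpleGraph (Fin k), ∑ r : Fin k × Fin k with r.1 ≠ r.2,
        (∫ p, g (p r.1, p r.2) * inducedWeight F U p ∂(Measure.pi fun _ : Fin k => π)) *
          R.drift F r.1 r.2 := by
  have hint : ∀ F : SimpleGraph (Fin k), ∀ r : Fin k × Fin k, r.1 ≠ r.2 →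
      Integrable (fun e => g e * rootedDensity π F r.1 r.2 U e.1 e.2) (π.prod π) := by
    intro F r hr
    refine Integrable.of_bound (C := D * weightBound k C)
      (hg.mul (measurable_rootedDensity F hr hU)).aestronglyMeasurable ?_
    filter_upwards [ae_abs_rootedDensity_le F hr hU (Filter.Eventually.of_forall hC)] with e he
    rw [Real.norm_eq_abs, abs_mul]
    exact mul_le_mul (hD _) he (abs_nonneg _) ((abs_nonneg _).trans (hD e))
  simp only [velocity_eq, Finset.mul_sum, ← mul_assoc]
  rw [integral_finsetSum _ fun F _ => integrable_finsetSum _ fun r hr =>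
    (hint F r (by simpa using hr)).mul_const _]
  refine Finset.sum_congr rfl fun F _ => ?_
  rw [integral_finsetSum _ fun r hr => (hint F r (by simpa using hr)).mul_const _]
  refine Finset.sum_congr rfl fun r hr => ?_
  rw [integral_mul_const, integral_mul_rootedDensity F (by simpa using hr) hU hg hC hD]

theorem integral_comp_finite {ι κ : Type*} [Fintype ι] [Fintype κ] [DecidableEq ι]
    [MeasurableSpace κ] [MeasurableSingletonClass κ] {τ : Ω → κ} (hτ : Measurable τ)
    (h : (ι → κ) → ℝ) :
    ∫ p, h (τ ∘ p) ∂(Measure.pi fun _ : ι => π) =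
      ∑ f : ι → κ, (∏ i, π.real (τ ⁻¹' {f i})) * h f := by
  have hm : Measurable fun p : ι → Ω => τ ∘ p :=
    measurable_pi_lambda _ fun i => hτ.comp (measurable_pi_apply i)
  have hp := Measure.isProbabilityMeasure_map (μ := π) hτ.aemeasurable
  have hmap : (Measure.pi fun _ : ι => π).map (fun p => τ ∘ p) =
      Measure.pi fun _ : ι => π.map τ :=
    Measure.pi_map_pi (μ := fun _ : ι => π) (f := fun _ => τ) fun _ => hτ.aemeasurable
  rw [← integral_map (f := h) hm.aemeasurable (measurable_of_finite h).aestronglyMeasurable, hmap,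
    integral_fintype Integrable.of_finite]
  refine Finset.sum_congr rfl fun f _ => ?_
  rw [smul_eq_mul, Measure.real, Measure.pi_singleton, ENNReal.toReal_prod]
  congr 1
  refine Finset.prod_congr rfl fun i _ => ?_
  rw [Measure.map_apply hτ (measurableSet_singleton _)]
  rfl

theorem IsAtomless.exists_uniform (hπ : IsAtomless π) {ι : Type*} [Fintype ι] [DecidableEq ι]
    [MeasurableSpace ι] [MeasurableSingletonClass ι] {S : Finset ι} (hS : S.Nonempty) :
    ∃ τ : Ω → ι, Measurable τ ∧
      ∀ i, π.real (τ ⁻¹' {i}) = if i ∈ S then (S.card : ℝ)⁻¹ else 0 := by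
  have hc : (S.card : ℝ) ≠ 0 := by exact_mod_cast hS.card_pos.ne'
  obtain ⟨τ, hτ, -, h⟩ := hπ.exists_measurable_forall_measureReal_eq Finset.univ
    (hS.mono (Finset.subset_univ S)) Set.univ (fun i => if i ∈ S then (S.card : ℝ)⁻¹ else 0)
    MeasurableSet.univ (fun i => by split_ifs <;> positivity) (by simp [hc])
  exact ⟨τ, hτ, fun i => by simpa using h i (Finset.mem_univ i)⟩

/-- Inclusion-exclusion as an induction on `S`: split the maps into `S` by their exact image; those
with smaller image already sum to zero. -/
theorem sum_image_eq_zero {ι κ : Type*} [Fintype ι] [Fintype κ] [DecidableEq ι] [DecidableEq κ]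
    [Nonempty ι] {Φ : (ι → κ) → ℝ}
    (h : ∀ S : Finset κ, S.Nonempty → ∑ f : ι → κ with ∀ i, f i ∈ S, Φ f = 0) (S : Finset κ) :
    ∑ f : ι → κ with Finset.univ.image f = S, Φ f = 0 := by
  induction S using Finset.strongInduction with
  | H S ih =>
    rcases S.eq_empty_or_nonempty with rfl | hS
    · exact Finset.sum_eq_zero fun f hf => by
        have h1 := Finset.univ_nonempty.image f
        rw [(Finset.mem_filter.1 hf).2] at h1
        exact absurd h1 Finset.not_nonempty_empty
    · have hmaps : ∀ f ∈ Finset.univ.filter (fun f : ι → κ => ∀ i, f i ∈ S),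
          Finset.univ.image f ∈ S.powerset := by
        intro f hf
        rw [Finset.mem_powerset, Finset.image_subset_iff]
        exact fun i _ => (Finset.mem_filter.1 hf).2 i
      have hfib := Finset.sum_fiberwise_of_maps_to hmaps Φ
      rw [h S hS, Finset.sum_eq_single_of_mem S (Finset.mem_powerset_self S)] at hfib
      · rw [← hfib, Finset.filter_filter]
        refine Finset.sum_congr (Finset.filter_congr fun f _ => ?_) fun _ _ => rfl
        refine ⟨fun hf => ⟨fun i => hf ▸ Finset.mem_image_of_mem f (Finset.mem_univ i), hf⟩,
          fun hf => hf.2⟩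
      · intro T hT hne
        have hTS : T ⊂ S := (Finset.mem_powerset.1 hT).ssubset_of_ne hne
        rw [← ih T hTS, Finset.filter_filter]
        refine Finset.sum_congr (Finset.filter_congr fun f _ => ?_) fun _ _ => rfl
        refine ⟨fun hf => hf.2, fun hf => ⟨fun i => hTS.1 ?_, hf⟩⟩
        exact hf ▸ Finset.mem_image_of_mem f (Finset.mem_univ i)

theorem sum_perm_eq_zero {ι : Type*} [Fintype ι] [DecidableEq ι] [Nonempty ι] {Φ : (ι → ι) → ℝ}
    (h : ∀ S : Finset ι, S.Nonempty → ∑ f : ι → ι with ∀ i, f i ∈ S, Φ f = 0) :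
    ∑ σ : Equiv.Perm ι, Φ σ = 0 := by
  rw [← sum_image_eq_zero h Finset.univ]
  refine Finset.sum_bij (fun σ _ => σ) (fun σ _ => ?_) (fun σ _ ρ _ h => DFunLike.coe_injective h)
    (fun f hf => ?_) fun _ _ => rfl
  · simp [Finset.image_univ_of_surjective σ.surjective]
  · have hs : Function.Surjective f := fun j => by
      have : j ∈ Finset.univ.image f := by
        rw [(Finset.mem_filter.1 hf).2]
        exact Finset.mem_univ j
      simpa using this
    exact ⟨Equiv.ofBijective f (Finite.surjective_iff_bijective.1 hs), Finset.mem_univ _, rfl⟩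

end StepKernels

/-! ### Invariance under relabelling -/

section Relabelling

variable {k : ℕ}

theorem relabel_adj_iff (σ : Equiv.Perm (Fin k)) (F : SimpleGraph (Fin k)) (i j : Fin k) :
    (relabel σ F).Adj i j ↔ F.Adj (σ⁻¹ i) (σ⁻¹ j) := by
  have := relabel_adj σ F (σ⁻¹ i) (σ⁻¹ j)
  simpa using this

theorem relabel_mul (σ ρ : Equiv.Perm (Fin k)) (F : SimpleGraph (Fin k)) :
    relabel (σ * ρ) F = relabel σ (relabel ρ F) := by
  ext i j
  simp [relabel_adj_iff]

@[simp]
theorem relabel_one (F : SimpleGraph (Fin k)) : relabel 1 F = F := by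
  ext i j
  simp [relabel_adj_iff]

@[simp]
theorem relabel_inv_relabel (σ : Equiv.Perm (Fin k)) (F : SimpleGraph (Fin k)) :
    relabel σ⁻¹ (relabel σ F) = F := by
  rw [← relabel_mul, inv_mul_cancel, relabel_one]

@[simp]
theorem relabel_relabel_inv (σ : Equiv.Perm (Fin k)) (F : SimpleGraph (Fin k)) :
    relabel σ (relabel σ⁻¹ F) = F := by
  rw [← relabel_mul, mul_inv_cancel, relabel_one]

/-- Relabelling by a fixed permutation, as a permutation of the set of graphs. -/
def relabelEquiv (σ : Equiv.Perm (Fin k)) : Equiv.Perm (SimpleGraph (Fin k)) where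
  toFun := relabel σ
  invFun := relabel σ⁻¹
  left_inv := relabel_inv_relabel σ
  right_inv := relabel_relabel_inv σ

theorem sum_relabel (σ : Equiv.Perm (Fin k)) (f : SimpleGraph (Fin k) → ℝ) :
    ∑ F, f (relabel σ F) = ∑ F, f F :=
  Equiv.sum_comp (relabelEquiv σ) f

theorem prod_lt_comp_perm (σ : Equiv.Perm (Fin k)) {h : Fin k → Fin k → ℝ}
    (hs : ∀ i j, i ≠ j → h i j = h j i) :
    ∏ e : Fin k × Fin k with e.1 < e.2, h (σ e.1) (σ e.2) =
      ∏ e : Fin k × Fin k with e.1 < e.2, h e.1 e.2 := by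
  -- Unordered pairs are stored as increasing ones, so `ρ` acts by moving and then sorting; `ρ⁻¹`
  -- undoes this in the same manner.
  have key : ∀ ρ : Equiv.Perm (Fin k), ∀ e : Fin k × Fin k, e.1 < e.2 →
      min (ρ e.1) (ρ e.2) < max (ρ e.1) (ρ e.2) ∧
      (min (ρ⁻¹ (min (ρ e.1) (ρ e.2))) (ρ⁻¹ (max (ρ e.1) (ρ e.2))),
        max (ρ⁻¹ (min (ρ e.1) (ρ e.2))) (ρ⁻¹ (max (ρ e.1) (ρ e.2)))) = e := by
    intro ρ e he
    have hne : ρ e.1 ≠ ρ e.2 := ρ.injective.ne he.ne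
    rcases hne.lt_or_gt with h1 | h1
    · simp [min_eq_left h1.le, max_eq_right h1.le, min_eq_left he.le, max_eq_right he.le, h1]
    · simp [min_eq_right h1.le, max_eq_left h1.le, min_eq_right he.le, max_eq_left he.le, h1]
  refine Finset.prod_nbij' (fun e => (min (σ e.1) (σ e.2), max (σ e.1) (σ e.2)))
    (fun e => (min (σ⁻¹ e.1) (σ⁻¹ e.2), max (σ⁻¹ e.1) (σ⁻¹ e.2))) ?_ ?_ ?_ ?_ ?_
  · intro e he
    simpa using (key σ e (by simpa using he)).1
  · intro e he
    simpa using (key σ⁻¹ e (by simpa using he)).1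
  · intro e he
    exact (key σ e (by simpa using he)).2
  · intro e he
    simpa using (key σ⁻¹ e (by simpa using he)).2
  · intro e he
    have hne : σ e.1 ≠ σ e.2 := σ.injective.ne (Finset.mem_filter.1 he).2.ne
    rcases hne.lt_or_gt with h1 | h1
    · simp [min_eq_left h1.le, max_eq_right h1.le]
    · simp only [min_eq_right h1.le, max_eq_left h1.le]
      exact hs _ _ hne

theorem inducedWeight_relabel {Ω : Type*} (σ : Equiv.Perm (Fin k)) (F : SimpleGraph (Fin k))
    {U : Ω × Ω → ℝ} {p : Fin k → Ω} (hU : ∀ i j, i ≠ j → U (p j, p i) = U (p i, p j)) :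
    inducedWeight (relabel σ F) U p = inducedWeight F U (p ∘ σ) := by
  classical
  unfold inducedWeight
  rw [← prod_lt_comp_perm σ (h := fun i j =>
    if (relabel σ F).Adj i j then U (p i, p j) else 1 - U (p i, p j))]
  · simp only [relabel_adj, Function.comp_apply]
  · intro i j hij
    simp only [hU i j hij, (relabel σ F).adj_comm i j]

variable {Ω : Type*} [MeasurableSpace Ω] {π : Measure Ω} [IsProbabilityMeasure π]

theorem rootedDensity_relabel (σ : Equiv.Perm (Fin k)) (F : SimpleGraph (Fin k)) {a b : Fin k}
    (hab : a ≠ b) {U : Ω × Ω → ℝ} (hU : Measurable U)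
    (hs : ∀ᵐ e ∂(π.prod π), U e.swap = U e) :
    ∀ᵐ e ∂(π.prod π), rootedDensity π (relabel σ F) (σ a) (σ b) U e.1 e.2 =
      rootedDensity π F a b U e.1 e.2 := by
  filter_upwards [ae_ae_rooted (σ.injective.ne hab) (ae_forall_pair hs)] with e he
  have hmp := measurePreserving_comp_injective π σ.injective
  rw [rootedDensity_eq _ _ _ hU, rootedDensity_eq _ _ _ hU]
  trans ∫ z, inducedWeight F U (rooted a b (e, z ∘ σ)) ∂(Measure.pi fun _ : Fin k => π)
  · refine integral_congr_ae (he.mono fun z hz => ?_)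
    simp only
    rw [inducedWeight_relabel σ F (p := rooted (σ a) (σ b) (e, z)) hz]
    congr 1
    funext i
    simp [rooted]
  · refine (integral_map (f := fun z => inducedWeight F U (rooted a b (e, z)))
      hmp.measurable.aemeasurable ?_).symm.trans (by rw [hmp.map_eq])
    exact ((measurable_inducedWeight F hU).comp (measurable_rooted_right a b e)).aestronglyMeasurable

end Relabelling

/-! ### Same trajectories means same orbit sums -/

section Criterion

variable {Ω : Type*} [MeasurableSpace Ω] {π : Measure Ω} [IsProbabilityMeasure π] {k : ℕ}

-- Each relabelling of the summation variables rewrites the same velocity; adding up all these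
-- expressions collects the drifts into orbit sums.
open Classical in
theorem card_mul_velocity (R : Rule k) {U : Ω × Ω → ℝ} (hU : Measurable U)
    (hs : ∀ᵐ e ∂(π.prod π), U e.swap = U e) :
    ∀ᵐ e ∂(π.prod π), (Fintype.card (Equiv.Perm (Fin k)) : ℝ) * velocity π R U e =
      ∑ F : SimpleGraph (Fin k), ∑ r : Fin k × Fin k with r.1 ≠ r.2,
        rootedDensity π F r.1 r.2 U e.1 e.2 *
          ∑ σ : Equiv.Perm (Fin k), R.drift (relabel σ F) (σ r.1) (σ r.2) := by
  have h : ∀ᵐ e ∂(π.prod π), ∀ (σ : Equiv.Perm (Fin k)) F a b, a ≠ b →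
      rootedDensity π (relabel σ F) (σ a) (σ b) U e.1 e.2 = rootedDensity π F a b U e.1 e.2 := by
    rw [ae_all_iff]
    exact fun σ => ae_forall_root fun F a b hab => rootedDensity_relabel σ F hab hU hs
  filter_upwards [h] with e he
  have hσ : ∀ σ : Equiv.Perm (Fin k), velocity π R U e =
      ∑ F : SimpleGraph (Fin k), ∑ r : Fin k × Fin k with r.1 ≠ r.2,
        rootedDensity π F r.1 r.2 U e.1 e.2 * R.drift (relabel σ F) (σ r.1) (σ r.2) := by
    intro σ
    rw [velocity_eq, ← sum_relabel σ]
    refine Finset.sum_congr rfl fun F _ => ?_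
    symm
    refine Finset.sum_nbij' (Prod.map σ σ) (Prod.map ⇑(σ⁻¹) ⇑(σ⁻¹)) ?_ ?_ ?_ ?_ ?_
    · simp
    · simp
    · simp
    · simp
    · intro r hr
      rw [Prod.map_fst, Prod.map_snd, he σ F r.1 r.2 (by simpa using hr)]
  simp only [Finset.mul_sum]
  rw [← nsmul_eq_mul, ← Finset.card_univ, ← Finset.sum_const]
  rw [Finset.sum_congr rfl fun σ _ => hσ σ, Finset.sum_comm]
  exact Finset.sum_congr rfl fun F _ => Finset.sum_comm

theorem kernelVelocity_eq_of_sum_drift_eq {R R' : Rule k}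
    (h : ∀ (F : SimpleGraph (Fin k)) (a b : Fin k), a ≠ b →
      ∑ σ : Equiv.Perm (Fin k), R.drift (relabel σ F) (σ a) (σ b) =
        ∑ σ : Equiv.Perm (Fin k), R'.drift (relabel σ F) (σ a) (σ b)) :
    kernelVelocity (π := π) R = kernelVelocity R' := by
  classical
  funext W
  refine Subtype.ext (Lp.ext ?_)
  have hs : ∀ᵐ e ∂(π.prod π), (W : Lp ℝ ∞ (π.prod π)) e.swap = (W : Lp ℝ ∞ (π.prod π)) e := W.2
  filter_upwards [coeFn_kernelVelocity R W, coeFn_kernelVelocity R' W,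
    card_mul_velocity R (measurable_coeFn _) hs, card_mul_velocity R' (measurable_coeFn _) hs]
    with e h1 h2 h3 h4
  rw [h1, h2]
  have hc : (Fintype.card (Equiv.Perm (Fin k)) : ℝ) ≠ 0 := by exact_mod_cast Fintype.card_ne_zero
  refine mul_left_cancel₀ hc ?_
  rw [h3, h4]
  refine Finset.sum_congr rfl fun F _ => Finset.sum_congr rfl fun r hr => ?_
  rw [h F r.1 r.2 (by simpa using hr)]

open Classical in
/-- The contribution of the sample `f` of cells to the velocity of `R` at a step kernel with
values `w`, tested against a step function with values `g`. -/
noncomputable def Rule.cellVelocity (R : Rule k) (w g : Fin k × Fin k → ℝ) (f : Fin k → Fin k) :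
    ℝ :=
  ∑ F : SimpleGraph (Fin k), ∑ r : Fin k × Fin k with r.1 ≠ r.2,
    (g (f r.1, f r.2) * inducedWeight F w f) * R.drift F r.1 r.2

theorem integral_step_mul_velocity (R : Rule k) (w g : Fin k × Fin k → ℝ) {τ : Ω → Fin k}
    (hτ : Measurable τ) :
    ∫ e, g (Prod.map τ τ e) * velocity π R (w ∘ Prod.map τ τ) e ∂(π.prod π) =
      ∑ f : Fin k → Fin k, (∏ i, π.real (τ ⁻¹' {f i})) * R.cellVelocity w g f := by
  classical
  have hbdd : ∀ h : Fin k × Fin k → ℝ, ∃ C, ∀ e, |h e| ≤ C := fun h =>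
    ⟨∑ e, |h e|, fun e => Finset.single_le_sum (f := fun e => |h e|) (fun _ _ => abs_nonneg _)
      (Finset.mem_univ e)⟩
  obtain ⟨C, hC⟩ := hbdd w
  obtain ⟨D, hD⟩ := hbdd g
  have hm : Measurable (Prod.map τ τ) := hτ.prodMap hτ
  refine (integral_mul_velocity (g := g ∘ Prod.map τ τ) R ((measurable_of_finite w).comp hm)
    ((measurable_of_finite g).comp hm) (fun e => hC _) fun e => hD _).trans ?_
  simp only [Rule.cellVelocity, Finset.mul_sum]
  rw [Finset.sum_comm (γ := Fin k → Fin k)]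
  refine Finset.sum_congr rfl fun F _ => ?_
  rw [Finset.sum_comm (γ := Fin k → Fin k)]
  refine Finset.sum_congr rfl fun r _ => ?_
  have := integral_comp_finite (π := π) hτ
    fun f : Fin k → Fin k => g (f r.1, f r.2) * inducedWeight F w f
  simp only [← mul_assoc]
  rw [← Finset.sum_mul]
  simp only [← mul_assoc] at this
  rw [← this]
  rfl

open Classical in
theorem inducedWeight_indicator (F F' : SimpleGraph (Fin k)) (σ : Equiv.Perm (Fin k)) :
    inducedWeight F' (fun e => if F.Adj e.1 e.2 then 1 else 0) σ =
      if F' = relabel σ⁻¹ F then 1 else 0 := by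
  have hadj : ∀ i j, (relabel σ⁻¹ F).Adj i j ↔ F.Adj (σ i) (σ j) := fun i j => by
    rw [relabel_adj_iff, inv_inv]
  unfold inducedWeight
  split_ifs with h
  · refine Finset.prod_eq_one fun e _ => ?_
    rw [h]
    by_cases hF : F.Adj (σ e.1) (σ e.2) <;> simp [hadj, hF]
  · have : ∃ i j, i < j ∧ ¬(F'.Adj i j ↔ F.Adj (σ i) (σ j)) := by
      by_contra! hcon
      refine h (SimpleGraph.ext ?_)
      ext i j
      rw [hadj]
      rcases lt_trichotomy i j with hij | rfl | hij
      · exact hcon i j hij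
      · simp
      · rw [F'.adj_comm, F.adj_comm]
        exact hcon j i hij
    obtain ⟨i, j, hij, hne⟩ := this
    refine Finset.prod_eq_zero (i := (i, j)) (by simpa using hij) ?_
    by_cases h1 : F'.Adj i j <;> by_cases h2 : F.Adj (σ i) (σ j) <;> simp_all

-- A bijective sample induces exactly one graph, and exactly one ordered pair of vertices lands in
-- the cell `(a, b)`, so a single drift survives.
open Classical in
theorem cellVelocity_perm (R : Rule k) (F : SimpleGraph (Fin k)) {a b : Fin k} (hab : a ≠ b)
    (σ : Equiv.Perm (Fin k)) :
    R.cellVelocity (fun e => if F.Adj e.1 e.2 then 1 else 0) (fun e => if e = (a, b) then 1 else 0)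
      σ = R.drift (relabel σ⁻¹ F) (σ⁻¹ a) (σ⁻¹ b) := by
  unfold Rule.cellVelocity
  simp only [inducedWeight_indicator]
  rw [Finset.sum_eq_single_of_mem (relabel σ⁻¹ F) (Finset.mem_univ _) fun F' _ hF' =>
      Finset.sum_eq_zero fun r _ => by simp [hF'],
    Finset.sum_eq_single_of_mem (σ⁻¹ a, σ⁻¹ b) (by simpa using hab)]
  · simp
  · rintro ⟨c, d⟩ - hr
    have : ¬((σ c, σ d) = (a, b)) := by
      rintro h
      rw [Prod.mk.injEq] at h
      refine hr ?_
      rw [← h.1, ← h.2]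
      simp
    simp only [if_neg this, zero_mul]

theorem sum_drift_eq_of_kernelVelocity_eq (hπ : IsAtomless π) {R R' : Rule k}
    (h : kernelVelocity (π := π) R = kernelVelocity R') (F : SimpleGraph (Fin k)) {a b : Fin k}
    (hab : a ≠ b) :
    ∑ σ : Equiv.Perm (Fin k), R.drift (relabel σ F) (σ a) (σ b) =
      ∑ σ : Equiv.Perm (Fin k), R'.drift (relabel σ F) (σ a) (σ b) := by
  classical
  have : Nonempty (Fin k) := ⟨a⟩
  set w : Fin k × Fin k → ℝ := fun e => if F.Adj e.1 e.2 then 1 else 0 with hw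
  set g : Fin k × Fin k → ℝ := fun e => if e = (a, b) then 1 else 0 with hg
  have hsum : ∀ S : Finset (Fin k), S.Nonempty →
      ∑ f : Fin k → Fin k with ∀ i, f i ∈ S, (R.cellVelocity w g f - R'.cellVelocity w g f) = 0 := by
    intro S hS
    obtain ⟨τ, hτ, hτS⟩ := hπ.exists_uniform hS
    have hm : Measurable (w ∘ Prod.map τ τ) := (measurable_of_finite w).comp (hτ.prodMap hτ)
    have hae := velocity_ae_eq_of_kernelVelocity_eq h hm (C := 1)
      (Filter.Eventually.of_forall fun e => by
        simp only [hw, Function.comp_apply]; split_ifs <;> simp)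
      (fun e => by simp only [hw, Function.comp_apply, Prod.map_fst, Prod.map_snd, Prod.fst_swap,
        Prod.snd_swap, F.adj_comm])
    have hint : ∫ e, g (Prod.map τ τ e) * velocity π R (w ∘ Prod.map τ τ) e ∂(π.prod π) =
        ∫ e, g (Prod.map τ τ e) * velocity π R' (w ∘ Prod.map τ τ) e ∂(π.prod π) :=
      integral_congr_ae (hae.mono fun e he => by simp only [he])
    rw [integral_step_mul_velocity R w g hτ, integral_step_mul_velocity R' w g hτ,
      ← sub_eq_zero, ← Finset.sum_sub_distrib] at hint
    -- The cells in `S` have equal measure and the others are null: every sample inside `S` has this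
    -- weight, all other samples weight 0.
    have hc : (S.card : ℝ)⁻¹ ^ k ≠ 0 := by
      have : (S.card : ℝ) ≠ 0 := by exact_mod_cast hS.card_pos.ne'
      positivity
    refine mul_left_cancel₀ hc ?_
    rw [mul_zero, ← hint, Finset.mul_sum, Finset.sum_filter]
    refine Finset.sum_congr rfl fun f _ => ?_
    simp only [hτS]
    split_ifs with hf
    · simp [hf, mul_sub]
    · obtain ⟨i, hi⟩ := not_forall.1 hf
      rw [Finset.prod_eq_zero (Finset.mem_univ i) (if_neg hi)]
      simp
  have hperm := sum_perm_eq_zero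
    (Φ := fun f => R.cellVelocity w g f - R'.cellVelocity w g f) fun S hS => by
      convert hsum S hS
  rw [Finset.sum_sub_distrib, sub_eq_zero] at hperm
  simp only [hw, hg, cellVelocity_perm _ F hab] at hperm
  rw [← Equiv.sum_comp (Equiv.inv (Equiv.Perm (Fin k))),
    ← Equiv.sum_comp (Equiv.inv (Equiv.Perm (Fin k)))
      fun σ => R'.drift (relabel σ F) (σ a) (σ b)]
  exact hperm

open Classical in
/-- The probability that `a b` is an edge after the rule `R` is applied to the graph `F`. -/
noncomputable def Rule.edgeProb (R : Rule k) (F : SimpleGraph (Fin k)) (a b : Fin k) : ℝ :=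
  ∑ H : SimpleGraph (Fin k), R.prob F H * (if H.Adj a b then 1 else 0)

/-- Two rules have the same trajectories if and only if the orbit sums of their edge
probabilities agree. -/
theorem haveSameTrajectories_iff_sum_edgeProb_eq (hπ : IsAtomless π) (R R' : Rule k) :
    HaveSameTrajectories π R R' ↔ ∀ (F : SimpleGraph (Fin k)) (a b : Fin k), a ≠ b →
      ∑ σ : Equiv.Perm (Fin k), R.edgeProb (relabel σ F) (σ a) (σ b) =
        ∑ σ : Equiv.Perm (Fin k), R'.edgeProb (relabel σ F) (σ a) (σ b) := by
  classical
  have hd : ∀ (R : Rule k) F a b,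
      R.drift F a b = R.edgeProb F a b - if F.Adj a b then 1 else 0 := fun _ _ _ _ => rfl
  rw [haveSameTrajectories_iff]
  constructor
  · intro h F a b hab
    have := sum_drift_eq_of_kernelVelocity_eq hπ h F hab
    simpa only [hd, Finset.sum_sub_distrib, sub_left_inj] using this
  · intro h
    refine kernelVelocity_eq_of_sum_drift_eq fun F a b hab => ?_
    simp only [hd, Finset.sum_sub_distrib, h F a b hab]

end Criterion

/-! ### Which rules are determined by their orbit sums -/

section Uniqueness

variable {k : ℕ}

theorem Rule.edgeProb_nonneg (R : Rule k) (F : SimpleGraph (Fin k)) (a b : Fin k) :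
    0 ≤ R.edgeProb F a b :=
  Finset.sum_nonneg fun H _ => mul_nonneg (R.nonneg F H) (by split_ifs <;> simp)

theorem Rule.edgeProb_le_one (R : Rule k) (F : SimpleGraph (Fin k)) (a b : Fin k) :
    R.edgeProb F a b ≤ 1 := by
  rw [← R.sum_eq_one F]
  refine Finset.sum_le_sum fun H _ => mul_le_of_le_one_right (R.nonneg F H) ?_
  split_ifs <;> simp

theorem Rule.edgeProb_relabel (R : Rule k) (F : SimpleGraph (Fin k)) (σ : Equiv.Perm (Fin k))
    (a b : Fin k) :
    R.edgeProb (relabel σ F) (σ a) (σ b) =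
      ∑ H : SimpleGraph (Fin k), R.prob (relabel σ F) (relabel σ H) *
        (open Classical in if H.Adj a b then 1 else 0) := by
  classical
  rw [Rule.edgeProb, ← sum_relabel σ]
  exact Finset.sum_congr rfl fun H _ => by simp only [relabel_adj]

theorem Rule.IsSymmetric.edgeProb_relabel {R : Rule k} (hR : R.IsSymmetric)
    (F : SimpleGraph (Fin k)) (σ : Equiv.Perm (Fin k)) (a b : Fin k) :
    R.edgeProb (relabel σ F) (σ a) (σ b) = R.edgeProb F a b := by
  rw [Rule.edgeProb_relabel, Rule.edgeProb]
  exact Finset.sum_congr rfl fun H _ => by rw [hR]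

-- A graph `H ≠ G` disagrees with `G` on some pair, where an edge probability of 0 or 1 leaves no
-- mass for `H`.
open Classical in
theorem Rule.prob_eq_of_edgeProb_eq (R : Rule k) {F G : SimpleGraph (Fin k)}
    (h : ∀ a b, a ≠ b → R.edgeProb F a b = if G.Adj a b then 1 else 0) (H : SimpleGraph (Fin k)) :
    R.prob F H = if H = G then 1 else 0 := by
  have hne : ∀ H, H ≠ G → R.prob F H = 0 := by
    intro H hH
    obtain ⟨a, b, hab⟩ : ∃ a b, ¬(H.Adj a b ↔ G.Adj a b) := by
      by_contra! hcon
      refine hH (SimpleGraph.ext ?_)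
      ext a b
      exact hcon a b
    have hne : a ≠ b := by
      rintro rfl
      simp at hab
    have hm := h a b hne
    by_cases hG : G.Adj a b
    · have hHab : ¬H.Adj a b := fun h' => hab ⟨fun _ => hG, fun _ => h'⟩
      rw [if_pos hG, ← R.sum_eq_one F, Rule.edgeProb, ← sub_eq_zero, ← Finset.sum_sub_distrib,
        ← neg_eq_zero, ← Finset.sum_neg_distrib] at hm
      have := (Finset.sum_eq_zero_iff_of_nonneg fun H _ => ?_).1 hm H (Finset.mem_univ H)
      · simpa [hHab] using this
      · have := R.nonneg F H
        split_ifs <;> linarith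
    · have hHab : H.Adj a b := by tauto
      rw [if_neg hG, Rule.edgeProb] at hm
      have := (Finset.sum_eq_zero_iff_of_nonneg fun H _ => ?_).1 hm H (Finset.mem_univ H)
      · simpa [hHab] using this
      · exact mul_nonneg (R.nonneg F H) (by split_ifs <;> simp)
  split_ifs with hH
  · subst hH
    rw [← R.sum_eq_one F]
    exact (Finset.sum_eq_single_of_mem _ (Finset.mem_univ _) fun H' _ hH' => hne H' hH').symm
  · exact hne H hH

/-- A rule obtained by prescribing nonnegative entries with row sums `1`. -/
noncomputable def Rule.ofNonneg (p : SimpleGraph (Fin k) → SimpleGraph (Fin k) → ℝ)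
    (h0 : ∀ F H, 0 ≤ p F H) (h1 : ∀ F, ∑ H, p F H = 1) : Rule k where
  prob := p
  nonneg := h0
  le_one F H := by
    rw [← h1 F]
    exact Finset.single_le_sum (fun H _ => h0 F H) (Finset.mem_univ H)
  sum_eq_one := h1

variable {Ω : Type*} [MeasurableSpace Ω] {π : Measure Ω} [IsProbabilityMeasure π]

theorem haveSameTrajectories_of_sum_prob_eq (hπ : IsAtomless π) {R R' : Rule k}
    (h : ∀ F H, ∑ σ : Equiv.Perm (Fin k), R.prob (relabel σ F) (relabel σ H) =
      ∑ σ : Equiv.Perm (Fin k), R'.prob (relabel σ F) (relabel σ H)) :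
    HaveSameTrajectories π R R' := by
  rw [haveSameTrajectories_iff_sum_edgeProb_eq hπ]
  intro F a b _
  have key : ∀ R : Rule k, ∑ σ : Equiv.Perm (Fin k), R.edgeProb (relabel σ F) (σ a) (σ b) =
      ∑ H, (∑ σ : Equiv.Perm (Fin k), R.prob (relabel σ F) (relabel σ H)) *
        (open Classical in if H.Adj a b then 1 else 0) := by
    intro R
    simp only [Rule.edgeProb_relabel, Finset.sum_mul]
    exact Finset.sum_comm
  rw [key, key]
  simp only [h]

theorem Rule.isUnique_of_isSymmetric_of_isDeterministic (hπ : IsAtomless π) {R : Rule k}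
    (hs : R.IsSymmetric) (hd : R.IsDeterministic) : R.IsUnique π := by
  classical
  intro R' h
  rw [haveSameTrajectories_iff_sum_edgeProb_eq hπ] at h
  ext F H
  obtain ⟨G, hG, -⟩ := hd F
  have hRG : ∀ a b, R.edgeProb F a b = if G.Adj a b then 1 else 0 := by
    intro a b
    rw [Rule.edgeProb, Finset.sum_eq_single_of_mem G (Finset.mem_univ G)]
    · simp [hG]
    · intro H _ hH
      simp [hG, hH]
  rw [hG, R'.prob_eq_of_edgeProb_eq (G := G)]
  intro a b hab
  have hsum := h F a b hab
  simp only [hs.edgeProb_relabel, hRG] at hsum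
  by_cases hadj : G.Adj a b
  · simp only [if_pos hadj] at hsum ⊢
    rw [← sub_eq_zero, ← Finset.sum_sub_distrib] at hsum
    have := (Finset.sum_eq_zero_iff_of_nonneg fun σ _ =>
      sub_nonneg.2 (R'.edgeProb_le_one _ _ _)).1 hsum 1 (Finset.mem_univ 1)
    simp only [relabel_one, Equiv.Perm.coe_one, id_eq] at this
    linarith
  · simp only [if_neg hadj, Finset.sum_const_zero] at hsum ⊢
    have := (Finset.sum_eq_zero_iff_of_nonneg fun σ _ => R'.edgeProb_nonneg _ _ _).1 hsum.symm 1
      (Finset.mem_univ 1)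
    simpa using this

theorem Rule.isUnique_of_two (hπ : IsAtomless π) (R : Rule 2) : R.IsUnique π := by
  classical
  have hgraph : ∀ H : SimpleGraph (Fin 2), H = if H.Adj 0 1 then ⊤ else ⊥ := by
    intro H
    ext i j
    have hc := H.adj_comm 1 0
    split_ifs with h <;> fin_cases i <;> fin_cases j <;> simp_all
  have hrel : ∀ (σ : Equiv.Perm (Fin 2)) (H : SimpleGraph (Fin 2)), relabel σ H = H := by
    intro σ H
    rw [hgraph H]
    split_ifs
    · ext i j
      simp [relabel_adj_iff]
    · ext i j
      simp [relabel_adj_iff]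
  have hsym : ∀ R : Rule 2, R.IsSymmetric := fun R F H σ => by rw [hrel, hrel]
  intro R' h
  rw [haveSameTrajectories_iff_sum_edgeProb_eq hπ] at h
  have hedge : ∀ F, R'.edgeProb F 0 1 = R.edgeProb F 0 1 := by
    intro F
    have := h F 0 1 (by simp)
    simp only [(hsym _).edgeProb_relabel, Finset.sum_const, nsmul_eq_mul] at this
    have hc : ((Finset.univ : Finset (Equiv.Perm (Fin 2))).card : ℝ) ≠ 0 := by
      exact_mod_cast Finset.card_ne_zero.2 Finset.univ_nonempty
    exact (mul_left_cancel₀ hc this).symm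
  have htop : ∀ (R : Rule 2) F, R.prob F ⊤ = R.edgeProb F 0 1 := by
    intro R F
    rw [Rule.edgeProb, Finset.sum_eq_single_of_mem ⊤ (Finset.mem_univ _)]
    · simp
    · intro H _ hH
      have := hgraph H
      split_ifs at this with h
      · exact absurd this hH
      · simp [h]
  have hbot : ∀ (R : Rule 2) F, R.prob F ⊥ = 1 - R.edgeProb F 0 1 := by
    intro R F
    rw [← R.sum_eq_one F, Rule.edgeProb, ← Finset.sum_sub_distrib,
      Finset.sum_eq_single_of_mem ⊥ (Finset.mem_univ _)]
    · simp
    · intro H _ hH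
      have := hgraph H
      split_ifs at this with h
      · simp [h]
      · exact absurd this hH
  ext F H
  rw [hgraph H]
  split_ifs
  · rw [htop, htop, hedge]
  · rw [hbot, hbot, hedge]

/-- The average of a rule over all relabellings. -/
noncomputable def Rule.symmetrization (R : Rule k) : Rule k :=
  Rule.ofNonneg
    (fun F H => (Fintype.card (Equiv.Perm (Fin k)) : ℝ)⁻¹ *
      ∑ σ : Equiv.Perm (Fin k), R.prob (relabel σ F) (relabel σ H))
    (fun F H => mul_nonneg (by positivity) (Finset.sum_nonneg fun σ _ => R.nonneg _ _))
    (fun F => by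
      rw [← Finset.mul_sum, Finset.sum_comm]
      simp only [sum_relabel _ (R.prob _), R.sum_eq_one, Finset.sum_const, Finset.card_univ,
        nsmul_eq_mul, mul_one]
      exact inv_mul_cancel₀ (by exact_mod_cast Fintype.card_ne_zero))

theorem Rule.symmetrization_isSymmetric (R : Rule k) : R.symmetrization.IsSymmetric := by
  intro F H ρ
  change _ * _ = _ * _
  congr 1
  simp only [← relabel_mul]
  exact Equiv.sum_comp (Equiv.mulRight ρ) fun σ => R.prob (relabel σ F) (relabel σ H)

theorem Rule.haveSameTrajectories_symmetrization (hπ : IsAtomless π) (R : Rule k) :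
    HaveSameTrajectories π R R.symmetrization := by
  refine haveSameTrajectories_of_sum_prob_eq hπ fun F H => ?_
  simp only [R.symmetrization_isSymmetric F H]
  rw [Finset.sum_const, Finset.card_univ, nsmul_eq_mul]
  exact (mul_inv_cancel_left₀ (by exact_mod_cast Fintype.card_ne_zero) _).symm

theorem Rule.IsUnique.isSymmetric (hπ : IsAtomless π) {R : Rule k} (h : R.IsUnique π) :
    R.IsSymmetric := by
  have := h _ (R.haveSameTrajectories_symmetrization hπ)
  rw [← this]
  exact R.symmetrization_isSymmetric

open Classical in
theorem Rule.exists_two_pos_of_not_isDeterministic {R : Rule k} (h : ¬R.IsDeterministic) :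
    ∃ F H₁ H₂, H₁ ≠ H₂ ∧ 0 < R.prob F H₁ ∧ 0 < R.prob F H₂ := by
  rw [Rule.IsDeterministic, not_forall] at h
  obtain ⟨F, hF⟩ := h
  by_contra! hcon
  obtain ⟨G, -, hG⟩ : ∃ G ∈ Finset.univ, 0 < R.prob F G :=
    Finset.exists_lt_of_sum_lt (by simp [R.sum_eq_one])
  have hzero : ∀ H, H ≠ G → R.prob F H = 0 := fun H hH =>
    (hcon F G H hH.symm hG).antisymm (R.nonneg F H)
  have hone : R.prob F G = 1 := by
    rw [← R.sum_eq_one F]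
    exact (Finset.sum_eq_single_of_mem G (Finset.mem_univ G) fun H _ hH => hzero H hH).symm
  refine hF ⟨G, fun H => ?_, fun G' hG' => ?_⟩
  · split_ifs with hH
    · rw [hH, hone]
    · exact hzero H hH
  · by_contra hne
    have := hG' G
    rw [if_neg (Ne.symm hne)] at this
    exact hG.ne' this

/-- The unit mass at the entry `(F', H')`. -/
noncomputable def unitMass (F' H' F H : SimpleGraph (Fin k)) : ℝ :=
  open Classical in if F = F' ∧ H = H' then 1 else 0

theorem unitMass_nonneg (F' H' F H : SimpleGraph (Fin k)) : 0 ≤ unitMass F' H' F H := by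
  unfold unitMass
  split_ifs <;> simp

theorem sum_unitMass (F' H' F : SimpleGraph (Fin k)) :
    ∑ H, unitMass F' H' F H = open Classical in if F = F' then 1 else 0 := by
  classical
  unfold unitMass
  split_ifs with h <;> simp [h]

theorem sum_unitMass_mul (F' H' F : SimpleGraph (Fin k)) (f : SimpleGraph (Fin k) → ℝ) :
    ∑ H, unitMass F' H' F H * f H = open Classical in if F = F' then f H' else 0 := by
  classical
  unfold unitMass
  split_ifs with h <;> simp [h]

theorem unitMass_relabel (σ : Equiv.Perm (Fin k)) (F' H' F H : SimpleGraph (Fin k)) :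
    unitMass (relabel σ F') (relabel σ H') (relabel σ F) (relabel σ H) = unitMass F' H' F H := by
  have hinj : Function.Injective (relabel σ) := (relabelEquiv σ).injective
  unfold unitMass
  by_cases h : F = F' ∧ H = H'
  · rw [if_pos h, if_pos ⟨congrArg _ h.1, congrArg _ h.2⟩]
  · rw [if_neg h, if_neg fun h' => h ⟨hinj h'.1, hinj h'.2⟩]

theorem sum_unitMass_relabel (ρ : Equiv.Perm (Fin k)) (F' H' F H : SimpleGraph (Fin k)) :
    ∑ σ, unitMass (relabel ρ F') (relabel ρ H') (relabel σ F) (relabel σ H) =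
      ∑ σ, unitMass F' H' (relabel σ F) (relabel σ H) := by
  rw [← Equiv.sum_comp (Equiv.mulLeft ρ)]
  simp only [Equiv.coe_mulLeft, relabel_mul, unitMass_relabel]

theorem le_prob_of_unitMass {R : Rule k} {F' H' : SimpleGraph (Fin k)} {ε : ℝ}
    (h : ε ≤ R.prob F' H') (F H : SimpleGraph (Fin k)) : ε * unitMass F' H' F H ≤ R.prob F H := by
  unfold unitMass
  split_ifs with hFH
  · rw [hFH.1, hFH.2, mul_one]
    exact h
  · rw [mul_zero]
    exact R.nonneg F H

/-- Otherwise shift mass `ε` from `H₂` to `H₁` in row `F` and from `σ · H₁` to `σ · H₂` in row `σ ·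
F`. Orbit sums do not change, but the entry `(F, H₁)` grows. -/
theorem Rule.IsUnique.relabel_eq (hπ : IsAtomless π) {R : Rule k} (h : R.IsUnique π)
    {F H₁ H₂ : SimpleGraph (Fin k)} (hne : H₁ ≠ H₂) (h1 : 0 < R.prob F H₁)
    (h2 : 0 < R.prob F H₂) (σ : Equiv.Perm (Fin k)) : relabel σ F = F ∧ relabel σ H₁ = H₁ := by
  classical
  by_contra hσ
  have hs := h.isSymmetric hπ
  -- Halved because the two depleted entries `(F, H₂)` and `(σ · F, σ · H₁)` may coincide.
  set ε := min (R.prob F H₁) (R.prob F H₂) / 2 with hε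
  have hε0 : 0 < ε := half_pos (lt_min h1 h2)
  have e1 : 2 * ε ≤ R.prob (relabel σ F) (relabel σ H₁) := by
    rw [hs]; linarith [min_le_left (R.prob F H₁) (R.prob F H₂)]
  have e2 : 2 * ε ≤ R.prob F H₂ := by linarith [min_le_right (R.prob F H₁) (R.prob F H₂)]
  let R' : Rule k := Rule.ofNonneg
    (fun F' H => R.prob F' H + ε * (unitMass F H₁ F' H - unitMass F H₂ F' H
      - unitMass (relabel σ F) (relabel σ H₁) F' H + unitMass (relabel σ F) (relabel σ H₂) F' H))
    (fun F' H => by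
      have l1 := le_prob_of_unitMass e1 F' H
      have l2 := le_prob_of_unitMass e2 F' H
      have l3 := mul_nonneg hε0.le (unitMass_nonneg F H₁ F' H)
      have l4 := mul_nonneg hε0.le (unitMass_nonneg (relabel σ F) (relabel σ H₂) F' H)
      linarith)
    (fun F' => by
      rw [Finset.sum_add_distrib, ← Finset.mul_sum, R.sum_eq_one]
      simp only [Finset.sum_add_distrib, Finset.sum_sub_distrib, sum_unitMass]
      ring)
  have hsame : HaveSameTrajectories π R R' := by
    refine haveSameTrajectories_of_sum_prob_eq hπ fun F' H => ?_
    change _ = ∑ σ', (_ + ε * _)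
    rw [Finset.sum_add_distrib, ← Finset.mul_sum]
    simp only [Finset.sum_add_distrib, Finset.sum_sub_distrib, sum_unitMass_relabel]
    ring
  have hR' := congrArg (fun S : Rule k => S.prob F H₁) (h R' hsame)
  change R.prob F H₁ + ε * _ = R.prob F H₁ at hR'
  have u1 : unitMass F H₁ F H₁ = 1 := by simp [unitMass]
  have u2 : unitMass F H₂ F H₁ = 0 := by simp [unitMass, hne]
  have u3 : unitMass (relabel σ F) (relabel σ H₁) F H₁ = 0 :=
    if_neg fun hc => hσ ⟨hc.1.symm, hc.2.symm⟩
  have u4 := mul_nonneg hε0.le (unitMass_nonneg (relabel σ F) (relabel σ H₂) F H₁)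
  rw [u1, u2, u3] at hR'
  linarith

theorem eq_bot_or_eq_top_of_relabel_eq {H : SimpleGraph (Fin k)} (h : ∀ σ, relabel σ H = H) :
    H = ⊥ ∨ H = ⊤ := by
  rw [or_iff_not_imp_left]
  intro hH
  obtain ⟨u, v, huv⟩ := SimpleGraph.ne_bot_iff_exists_adj.1 hH
  ext a b
  rw [SimpleGraph.top_adj]
  refine ⟨fun hab => hab.ne, fun hab => ?_⟩
  -- The first swap takes `u` to `a`; the second takes the image of `v` to `b` and fixes `a`. So the
  -- edge `u v` is carried to the pair `a b`.
  have key := relabel_adj (Equiv.swap (Equiv.swap u a v) b * Equiv.swap u a) H u v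
  rw [h] at key
  have hav : a ≠ Equiv.swap u a v := by
    intro hc
    have := congrArg (Equiv.swap u a) hc
    simp only [Equiv.swap_apply_right, Equiv.swap_apply_self] at this
    exact huv.ne this
  simpa [Equiv.swap_apply_of_ne_of_ne hav hab, huv] using key

/-- A graph and its complement together cover each pair exactly once, as do `⊥` and `⊤`. Exchanging
mass between these two couples preserves all edge probabilities; a third vertex keeps the single
edge `E` different from `⊤`. -/
theorem Rule.IsUnique.not_bot_top (hπ : IsAtomless π) {R : Rule k} (hk : 3 ≤ k)
    (h : R.IsUnique π) {F : SimpleGraph (Fin k)} (h1 : 0 < R.prob F ⊥) (h2 : 0 < R.prob F ⊤) :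
    False := by
  classical
  let i : Fin k := ⟨0, by omega⟩
  let j : Fin k := ⟨1, by omega⟩
  let l : Fin k := ⟨2, by omega⟩
  have hij : i ≠ j := by simp [i, j]
  have hil : i ≠ l := by simp [i, l]
  have hjl : j ≠ l := by simp [j, l]
  let E : SimpleGraph (Fin k) := SimpleGraph.edge i j
  have hEij : E.Adj i j := by simp [E, SimpleGraph.edge_adj, hij]
  have hEil : ¬E.Adj i l := by simp [E, SimpleGraph.edge_adj, hij, hil, hjl.symm]
  have hEbot : E ≠ ⊥ := fun hE => by rw [hE] at hEij; exact hEij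
  have hEtop : E ≠ ⊤ := fun hE => hEil (by rw [hE]; exact hil)
  set ε := min (R.prob F ⊥) (R.prob F ⊤) / 2 with hε
  have hε0 : 0 < ε := half_pos (lt_min h1 h2)
  have e1 : 2 * ε ≤ R.prob F ⊥ := by linarith [min_le_left (R.prob F ⊥) (R.prob F ⊤)]
  have e2 : 2 * ε ≤ R.prob F ⊤ := by linarith [min_le_right (R.prob F ⊥) (R.prob F ⊤)]
  let R' : Rule k := Rule.ofNonneg
    (fun F' H => R.prob F' H +
      ε * (unitMass F E F' H + unitMass F Eᶜ F' H - unitMass F ⊥ F' H - unitMass F ⊤ F' H))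
    (fun F' H => by
      have l1 := le_prob_of_unitMass e1 F' H
      have l2 := le_prob_of_unitMass e2 F' H
      have l3 := mul_nonneg hε0.le (unitMass_nonneg F E F' H)
      have l4 := mul_nonneg hε0.le (unitMass_nonneg F Eᶜ F' H)
      linarith)
    (fun F' => by
      rw [Finset.sum_add_distrib, ← Finset.mul_sum, R.sum_eq_one]
      simp only [Finset.sum_add_distrib, Finset.sum_sub_distrib, sum_unitMass]
      ring)
  have hedge : ∀ F' a b, a ≠ b → R'.edgeProb F' a b = R.edgeProb F' a b := by
    intro F' a b hab
    change ∑ H, (_ + ε * _) * _ = _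
    simp only [add_mul, sub_mul, mul_assoc, Finset.sum_add_distrib, Finset.sum_sub_distrib,
      ← Finset.mul_sum, sum_unitMass_mul]
    rw [Rule.edgeProb]
    by_cases hF : F' = F
    · by_cases hE : E.Adj a b <;> simp [hF, hE, hab]
    · simp [hF]
  have hsame : HaveSameTrajectories π R R' := by
    rw [haveSameTrajectories_iff_sum_edgeProb_eq hπ]
    intro F' a b hab
    exact Finset.sum_congr rfl fun σ _ => (hedge _ _ _ (σ.injective.ne hab)).symm
  have hR' := congrArg (fun S : Rule k => S.prob F E) (h R' hsame)
  change R.prob F E + ε * _ = R.prob F E at hR'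
  have u1 : unitMass F E F E = 1 := by simp [unitMass]
  have u2 : unitMass F ⊥ F E = 0 := by simp [unitMass, hEbot]
  have u3 : unitMass F ⊤ F E = 0 := by simp [unitMass, hEtop]
  have u4 := mul_nonneg hε0.le (unitMass_nonneg F Eᶜ F E)
  rw [u1, u2, u3] at hR'
  linarith

theorem Rule.IsUnique.isDeterministic (hπ : IsAtomless π) {R : Rule k} (hk : 3 ≤ k)
    (h : R.IsUnique π) : R.IsDeterministic := by
  by_contra hd
  obtain ⟨F, H₁, H₂, hne, h1, h2⟩ := R.exists_two_pos_of_not_isDeterministic hd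
  rcases eq_bot_or_eq_top_of_relabel_eq fun σ => (h.relabel_eq hπ hne h1 h2 σ).2 with rfl | rfl <;>
    rcases eq_bot_or_eq_top_of_relabel_eq fun σ => (h.relabel_eq hπ hne.symm h2 h1 σ).2
      with rfl | rfl
  · exact hne rfl
  · exact h.not_bot_top hπ hk h1 h2
  · exact h.not_bot_top hπ hk h2 h1
  · exact hne rfl

open Classical in
theorem Rule.isDeterministic_of_subsingleton [Subsingleton (SimpleGraph (Fin k))] (R : Rule k) :
    R.IsDeterministic := by
  by_contra h
  obtain ⟨F, H₁, H₂, hne, -⟩ := R.exists_two_pos_of_not_isDeterministic h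
  exact hne (Subsingleton.elim _ _)

end Uniqueness

end FlipProcess

theorem mainTheorem2 {Ω : Type*} [MeasurableSpace Ω] (π : Measure Ω) [IsProbabilityMeasure π]
    [IsSeparable π] (hπ : FlipProcess.IsAtomless π) (k : ℕ) (hk : 1 ≤ k)
    (R : FlipProcess.Rule k) :
    FlipProcess.Rule.IsUnique π R ↔ (R.IsSymmetric ∧ R.IsDeterministic) ∨ k = 2 := by
  constructor
  · intro h
    rcases (by omega : k = 1 ∨ k = 2 ∨ 3 ≤ k) with rfl | hk2 | hk3
    · have : Subsingleton (SimpleGraph (Fin 1)) := ⟨fun G H => by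
        ext i j
        simp [Subsingleton.elim i j]⟩
      exact Or.inl ⟨h.isSymmetric hπ, R.isDeterministic_of_subsingleton⟩
    · exact Or.inr hk2
    · exact Or.inl ⟨h.isSymmetric hπ, h.isDeterministic hπ hk3⟩
  · rintro (⟨hs, hd⟩ | rfl)
    · exact FlipProcess.Rule.isUnique_of_isSymmetric_of_isDeterministic hπ hs hd
    · exact R.isUnique_of_two hπ
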